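/- Let $\Sigma$ be a finite alphabet and let $L\subseteq\Sigma^*$ be a regular language. For $u,v\in\Sigma^*$ write $u\sqsubseteq v$ if $u$ is a (scattered) subword of $v$, $u\sqsubset v$ if moreover $u\neq v$, and say that $w$ is a cover of $u$ if $u\sqsubset w$ and there is no $v\in\Sigma^*$ with $u\sqsubset v\sqsubset w$. Let $\mathcal S$ be the structure with universe $L$, the binary relations $\sqsubseteq$ and "is covered by" restricted to $L$, the unary relation $K\cap L$ for every regular language $K\subseteq\Sigma^*$, and every word $w\in L$ as a constant. Formulas of the logic $\mathrm{C{+}MOD}^2$ over $\mathcal S$ use only two variables $x,y$. They are built from the atomic formulas $s=t$, $s\sqsubseteq t$, "$s$ is covered by $t$" and $s\in K$ ($s,t$ variables or constants, $K$ regular, given by a finite automaton) by means of $\neg$, $\wedge$, $\exists z$, the threshold counting quantifiers $\exists^{\geq k}z$ ($k\in\mathbb N$; "at least $k$ elements $z$ of $L$ satisfy ...") and the modulo counting quantifiers $\exists^{p\bmod q}z$ ($p,q\in\mathbb N$, $p<q$; "the number of elements $z$ of $L$ satisfying ... is finite and belongs to $p+q\mathbb N$"), where $z\in\{x,y\}$.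 Then the $\mathrm{C{+}MOD}^2$-theory of $\mathcal S$, that is, the set of all $\mathrm{C{+}MOD}^2$-sentences that hold in $\mathcal S$, is decidable. -/

import Mathlib

namespace CMod

/-- `u` is a proper (scattered) subword of `v`; the subword order is `List.Sublist`. -/
def ProperSubword {A : Type*} (u v : List A) : Prop :=
  u.Sublist v ∧ u ≠ v

/-- `w` is a cover of `u`: `u` is a proper subword of `w` and no word over the alphabet (in the
language under consideration or not) lies properly between them. -/
def Covers {A : Type*} (u w : List A) : Prop :=
  ProperSubword u w ∧ ¬ ∃ v : List A, ProperSubword u v ∧ ProperSubword v w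

/-- A finite (nondeterministic) automaton as a finite object: the lists of its transitions, of its
initial states and of its accepting states, where states are natural numbers. Such automata are
the names of the regular languages in formulas. -/
structure Automaton (A : Type*) where
  transitions : List (ℕ × A × ℕ)
  initial : List ℕ
  accepting : List ℕ

/-- The automaton as one of Mathlib's automata. -/
def Automaton.toNFA {A : Type*} (M : Automaton A) : NFA A ℕ where
  step s a := {t | (s, a, t) ∈ M.transitions}
  start := {s | s ∈ M.initial}
  accept := {s | s ∈ M.accepting}

/-- The language accepted by the automaton. -/
def Automaton.language {A : Type*} (M : Automaton A) : Language A :=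
  M.toNFA.accepts

/-- Terms: one of the two variables, or a constant from `L`. -/
inductive Term {A : Type*} (L : Language A) where
  | var (x : Fin 2)
  | const (w : {w : List A // w ∈ L})

/-- Formulas of the logic `C+MOD` with only two variables over the signature of the structure
`(L, ⊑, cover relation, (K ∩ L) for K regular, (w) for w ∈ L)`. -/
inductive Formula {A : Type*} (L : Language A) where
  | eq (s t : Term L)
  | subword (s t : Term L)
  | covers (s t : Term L)
  | mem (M : Automaton A) (t : Term L)
  | not (φ : Formula L)
  | and (φ ψ : Formula L)
  | ex (x : Fin 2) (φ : Formula L)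
  /-- the threshold counting quantifier: there are at least `k` many `x` with `φ` -/
  | exGE (k : ℕ) (x : Fin 2) (φ : Formula L)
  /-- the modulo counting quantifier, with `p < q`: the number of `x` with `φ` is finite and
  congruent to `p` modulo `q` -/
  | exMod (q : ℕ) (p : Fin q) (x : Fin 2) (φ : Formula L)

/-- The variables of a term. -/
def Term.vars {A : Type*} {L : Language A} : Term L → Finset (Fin 2)
  | .var x => {x}
  | .const _ => ∅

/-- The free variables of a formula. -/
def Formula.freeVars {A : Type*} {L : Language A} : Formula L → Finset (Fin 2)
  | .eq s t => s.vars ∪ t.vars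
  | .subword s t => s.vars ∪ t.vars
  | .covers s t => s.vars ∪ t.vars
  | .mem _ t => t.vars
  | .not φ => φ.freeVars
  | .and φ ψ => φ.freeVars ∪ ψ.freeVars
  | .ex x φ => φ.freeVars.erase x
  | .exGE _ x φ => φ.freeVars.erase x
  | .exMod _ _ x φ => φ.freeVars.erase x

/-- A sentence is a formula without free variables. -/
def Formula.IsSentence {A : Type*} {L : Language A} (φ : Formula L) : Prop :=
  φ.freeVars = ∅

/-- The value of a term. -/
def Term.val {A : Type*} {L : Language A} (v : Fin 2 → List A) : Term L → List A
  | .var x => v x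
  | .const w => w

/-- Satisfaction in the structure with universe `L`. Quantifiers range over `L`. Assignments may
take arbitrary words as values, so that there is an assignment even if `L` is empty; for sentences
the assignment is irrelevant (`Formula.sat_congr`). -/
def Formula.Sat {A : Type*} {L : Language A} : (Fin 2 → List A) → Formula L → Prop
  | v, .eq s t => s.val v = t.val v
  | v, .subword s t => (s.val v).Sublist (t.val v)
  | v, .covers s t => Covers (s.val v) (t.val v)
  | v, .mem M t => t.val v ∈ M.language ∧ t.val v ∈ L
  | v, .not φ => ¬ φ.Sat v
  | v, .and φ ψ => φ.Sat v ∧ ψ.Sat v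
  | v, .ex x φ => ∃ w ∈ L, φ.Sat (Function.update v x w)
  | v, .exGE k x φ => (k : ℕ∞) ≤ {w : List A | w ∈ L ∧ φ.Sat (Function.update v x w)}.encard
  | v, .exMod q p x φ => ∃ n : ℕ,
      {w : List A | w ∈ L ∧ φ.Sat (Function.update v x w)}.encard = (((p : ℕ) + q * n : ℕ) : ℕ∞)

/-- The two-variable `C+MOD`-theory of
`(L, ⊑, cover relation, (K ∩ L) for K regular, (w) for w ∈ L)`. -/
def theory {A : Type*} (L : Language A) : Set (Formula L) :=
  {φ | φ.IsSentence ∧ ∀ v : Fin 2 → List A, φ.Sat v}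

/-- The code of an automaton. -/
def Automaton.code {A : Type*} [Encodable A] (M : Automaton A) : ℕ :=
  Encodable.encode (M.transitions, M.initial, M.accepting)

/-- The code of a term; a constant is coded by the word it denotes. -/
def Term.code {A : Type*} [Encodable A] {L : Language A} : Term L → ℕ
  | .var x => Nat.pair 0 x
  | .const w => Nat.pair 1 (Encodable.encode w.1)

/-- The Gödel number of a formula. -/
def Formula.code {A : Type*} [Encodable A] {L : Language A} : Formula L → ℕ
  | .eq s t => Nat.pair 0 (Nat.pair s.code t.code)
  | .subword s t => Nat.pair 1 (Nat.pair s.code t.code)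
  | .covers s t => Nat.pair 2 (Nat.pair s.code t.code)
  | .mem M t => Nat.pair 3 (Nat.pair M.code t.code)
  | .not φ => Nat.pair 4 φ.code
  | .and φ ψ => Nat.pair 5 (Nat.pair φ.code ψ.code)
  | .ex x φ => Nat.pair 6 (Nat.pair x φ.code)
  | .exGE k x φ => Nat.pair 7 (Nat.pair k (Nat.pair x φ.code))
  | .exMod q p x φ => Nat.pair 8 (Nat.pair q (Nat.pair p (Nat.pair x φ.code)))

/-- A set of formulas is decidable if the set of Gödel numbers of its members is a computable
set of natural numbers. -/
def IsDecidable {A : Type*} [Encodable A] {L : Language A} (T : Set (Formula L)) : Prop :=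
  ComputablePred fun n : ℕ => ∃ φ ∈ T, φ.code = n

theorem Automaton.code_injective {A : Type*} [Encodable A] :
    Function.Injective (Automaton.code (A := A)) := by
  rintro ⟨a, b, c⟩ ⟨a', b', c'⟩ h
  have h' := Encodable.encode_injective h
  simp_all

theorem Term.code_injective {A : Type*} [Encodable A] {L : Language A} :
    Function.Injective (Term.code (L := L)) := by
  rintro (x | ⟨w, hw⟩) (y | ⟨w', hw'⟩) h
  all_goals simp [Term.code, Nat.pair_eq_pair, Fin.val_inj] at h
  all_goals simp_all

/-- Distinct formulas have distinct Gödel numbers. -/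
theorem Formula.code_injective {A : Type*} [Encodable A] {L : Language A} :
    Function.Injective (Formula.code (L := L)) := by
  intro φ
  induction φ with
  | exMod q p x φ ih =>
    intro ψ h
    cases ψ <;> simp [Formula.code, Nat.pair_eq_pair] at h
    obtain ⟨rfl, h1, h2, h3⟩ := h
    rw [Fin.ext h1, Fin.ext h2, ih h3]
  | _ =>
    intro ψ h
    cases ψ <;> simp [Formula.code, Nat.pair_eq_pair] at h
    all_goals
      simp [Term.code_injective.eq_iff, Automaton.code_injective.eq_iff, Fin.val_inj] at h ⊢
      grind

/-- The truth value of a formula depends only on the values of its free variables. -/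
theorem Formula.sat_congr {A : Type*} {L : Language A} (φ : Formula L) :
    ∀ v v' : Fin 2 → List A, (∀ x ∈ φ.freeVars, v x = v' x) → (φ.Sat v ↔ φ.Sat v') := by
  have ht : ∀ (t : Term L) (v v' : Fin 2 → List A), (∀ x ∈ t.vars, v x = v' x) →
      t.val v = t.val v' := by
    rintro (x | w) v v' h
    · exact h x (by simp [Term.vars])
    · rfl
  have hu : ∀ (s : Finset (Fin 2)) (x : Fin 2) (v v' : Fin 2 → List A) (w : List A),
      (∀ y ∈ s.erase x, v y = v' y) →
      ∀ y ∈ s, Function.update v x w y = Function.update v' x w y := by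
    intro s x v v' w h y hy
    by_cases hyx : y = x
    · subst hyx; simp
    · simpa [hyx] using h y (by simp [hyx, hy])
  induction φ with
  | eq s t | subword s t | covers s t =>
    intro v v' h
    simp only [Formula.Sat]
    rw [ht s v v' fun x hx => h x (Finset.mem_union_left _ hx),
      ht t v v' fun x hx => h x (Finset.mem_union_right _ hx)]
  | mem M t =>
    intro v v' h
    simp only [Formula.Sat]
    rw [ht t v v' h]
  | not φ ih =>
    intro v v' h
    simp only [Formula.Sat]
    rw [ih v v' h]
  | and φ ψ ih1 ih2 =>
    intro v v' h
    simp only [Formula.Sat]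
    rw [ih1 v v' fun x hx => h x (Finset.mem_union_left _ hx),
      ih2 v v' fun x hx => h x (Finset.mem_union_right _ hx)]
  | ex x φ ih | exGE _ x φ ih | exMod _ _ x φ ih =>
    intro v v' h
    simp only [Formula.Sat, fun w => ih _ _ (hu _ x v v' w h)]

/-- The languages named by automata are exactly the regular languages. -/
theorem isRegular_iff_exists_automaton {A : Type*} [Finite A] (K : Language A) :
    K.IsRegular ↔ ∃ M : Automaton A, M.language = K := by
  classical
  constructor
  · rintro ⟨σ, hσ, D, rfl⟩
    have := Fintype.ofFinite A
    let e := Fintype.equivFin σ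
    let M : Automaton A := ⟨(Finset.univ : Finset (σ × A)).toList.map fun p =>
      ((e p.1 : ℕ), p.2, (e (D.step p.1 p.2) : ℕ)), [(e D.start : ℕ)],
      ((Finset.univ : Finset σ).filter (· ∈ D.accept)).toList.map fun s => (e s : ℕ)⟩
    have hstep : ∀ s a, M.toNFA.step (e s : ℕ) a = {(e (D.step s a) : ℕ)} := by
      intro s a
      ext t
      simp [M, Automaton.toNFA, Fin.val_inj, eq_comm]
    have heval : ∀ (w : List A) (s : σ),
        M.toNFA.evalFrom {(e s : ℕ)} w = {(e (D.evalFrom s w) : ℕ)} := by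
      intro w
      induction w with
      | nil => intro s; rfl
      | cons a w ih =>
        intro s
        rw [NFA.evalFrom_cons, NFA.stepSet_singleton, hstep, ih, DFA.evalFrom_cons]
    have hstart : M.toNFA.start = {(e D.start : ℕ)} := by
      ext t
      simp [M, Automaton.toNFA]
    have hacc : ∀ s : σ, (e s : ℕ) ∈ M.toNFA.accept ↔ s ∈ D.accept := by
      intro s
      simp [M, Automaton.toNFA, Fin.val_inj]
    refine ⟨M, ?_⟩
    ext w
    rw [DFA.mem_accepts, DFA.eval, ← hacc]
    change (∃ s ∈ M.toNFA.accept, s ∈ M.toNFA.evalFrom M.toNFA.start w) ↔ _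
    rw [hstart, heval]
    simp
  · rintro ⟨M, rfl⟩
    let F : Set ℕ := {t | t ∈ M.initial} ∪ {t | t ∈ M.transitions.map fun p => p.2.2}
    have hF : F.Finite := (List.finite_toSet _).union (List.finite_toSet _)
    have hM : ∀ w : List A, M.toNFA.evalFrom M.toNFA.start w ⊆ F := by
      intro w
      induction w using List.reverseRecOn with
      | nil => exact Set.subset_union_left
      | append_singleton w a ih =>
        intro t ht
        rw [NFA.evalFrom_append, NFA.evalFrom_singleton, NFA.mem_stepSet] at ht
        obtain ⟨s, -, hs⟩ := ht
        exact Or.inr (List.mem_map_of_mem (f := fun p => p.2.2) hs)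
    apply Language.IsRegular.of_finite_range_leftQuotient
    refine (hF.finite_subsets.image M.toNFA.acceptsFrom).subset ?_
    rintro _ ⟨w, rfl⟩
    refine ⟨_, hM w, ?_⟩
    ext y
    exact (NFA.append_mem_acceptsFrom _).symm

end CMod

/-!
The theory is decided by evaluating formulas with bounded quantifiers. No automaton for a formula is
ever computed: the automata-theoretic part of the argument only shows that small automata exist, and
hence that the quantifiers may be bounded.

**Recognizability.** The set of pairs `(x, y)` that satisfy a formula is determined by a right
congruence with finitely many classes: the truth value depends only on the classes of `x` and of `y`
and on the atomic type of the pair (equality, subword order, cover relation). This is `Recog`. The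
crucial case of the induction is a counting quantifier (`Recog.count`). For a fixed class `s`, the
numbers of words `y` in `s` that are equal to `x`, covers of `x`, other superwords, ..., or
incomparable to `x` are, together with some auxiliary numbers, a vector over `ℕ∞` that is transformed
linearly when a letter is appended to `x` (`kindCount_append_singleton`): each word related to
`x ++ [a]` has a unique decomposition `y' ++ z` with `y'` related to `x` and `z` in a language that
depends only on `a` and on the two relations. For incomparability, this uses a case distinction on
the lengths: if `y` is at least as long as `x`, then incomparability means that `x` is not a subword
of `y`, and a last letter can be split off from `y` unless the part before it is already a superword
of `x`; similarly for shorter `y`. Since counting up to a threshold and a modulus is a semiring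
congruence on `ℕ∞`, the class of that vector is again a right congruence with finitely many classes.
The number of classes is bounded by an explicit primitive recursive function of the code of the
formula (`Formula.recog`, `stateBound`).

**Bounded quantifiers.** For fixed `x`, the set of all `y` with a recognized property can be pumped
(`Recog.exists_pump`): it is infinite if and only if it has an element whose length lies between `B`
and `2 * B`, for a bound `B` given by the number of classes and the length of `x`, and otherwise all
its elements are shorter than `B`. So the number of witnesses of a quantifier is found by testing
finitely many words (`encard_eq_length_filter`).

**Computability.** Hence the truth value of a formula under an assignment is given by a recursion on
the code of the formula in which the assignment varies in a primitive recursive way. Well-formedness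
and the free variables are computed by a similar recursion (`primrec_freeVarsOfCode`,
`primrecPred_satCode`).
-/

namespace CMod

open List

/-! ### Auxiliary relations between words and their decomposition -/

/-- Names of auxiliary relations between a word `x` and a word `y`; see `KindRel`. Every pair of
words is related by exactly one of the principal kinds (`Kind.IsPrincipal`); the other kinds are
needed to make the recursion on `x` close up. -/
inductive Kind (A : Type*) where
  | sup (i : Fin 3)
  | sub (o : Option A) (i : Fin 3)
  | minSup
  | notSup
  | notSub

/-- The relation named by a kind. Differences of lengths are recorded up to the cap `2`.
* `sup i`: `y` is a superword of `x` with capped excess `i`;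
* `sub o i`: `y` is a subword of `x` with capped deficit `i` and, if `o` is a letter, `y`
  followed by this letter is no longer a subword of `x`;
* `minSup`: `y` is a superword of `x`, but no proper prefix of `y` is;
* `notSup`: `y` is no superword of `x`, and at least as long as `x`;
* `notSub`: `y` is no subword of `x`, and shorter than `x`.

The last two kinds together are incomparability. -/
def KindRel {A : Type*} : Kind A → List A → List A → Prop
  | .sup i, x, y => x.Sublist y ∧ min (y.length - x.length) 2 = i
  | .sub o i, x, y => y.Sublist x ∧ (∀ b, o = some b → ¬ (y ++ [b]).Sublist x) ∧
      min (x.length - y.length) 2 = i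
  | .minSup, x, y => x.Sublist y ∧ ∀ y' b, y = y' ++ [b] → ¬ x.Sublist y'
  | .notSup, x, y => x.length ≤ y.length ∧ ¬ x.Sublist y
  | .notSub, x, y => y.length < x.length ∧ ¬ y.Sublist x

/-- The possible factors `z` in the decomposition of a word `y` related to `x ++ [a]` by the kind
`t`: `y = y' ++ z` where `y'` is related to `x` by `t'` and `KindStep a t' t z`. By
`exists_kindRel_of_append_singleton`, `KindRel.append` and `kindStep_unique`, each such `y` has
exactly one decomposition of this form and every such product is related to `x ++ [a]` by `t`. -/
def KindStep {A : Type*} (a : A) : Kind A → Kind A → List A → Prop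
  | .sup j, .sup i, z => ∃ z', z = a :: z' ∧ a ∉ z' ∧ min (j + z'.length) 2 = i
  | .sub o j, .sub o' i, z =>
      (o = some a ∧ z = [a] ∧ j = i) ∨
      (o = o' ∧ o ≠ some a ∧ z = [] ∧ min ((j : ℕ) + 1) 2 = i)
  | .minSup, .minSup, z => ∃ z', z = z' ++ [a] ∧ a ∉ z'
  | .minSup, .notSup, z => z ≠ [] ∧ a ∉ z
  | .notSup, .notSup, z => z.length = 1
  | .notSub, .notSub, z => z.length = 1
  | .sub o j, .notSub, z => 1 ≤ (j : ℕ) ∧ ∃ b, b ≠ a ∧ o = some b ∧ z = [b]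
  | _, _, _ => False

theorem append_singleton_sublist_append_singleton {A : Type*} {x y : List A} {a b : A} :
    (x ++ [a]).Sublist (y ++ [b]) ↔ (a = b ∧ x.Sublist y) ∨ (x ++ [a]).Sublist y := by
  constructor
  · intro h
    rw [← List.reverse_sublist] at h
    simp only [reverse_append, reverse_cons, reverse_nil, nil_append, singleton_append] at h
    cases h with
    | cons _ h =>
      right; rw [← List.reverse_sublist]; simpa using h
    | cons_cons _ h => left; exact ⟨rfl, by rw [← List.reverse_sublist]; exact h⟩
  · rintro (⟨rfl, h⟩ | h)
    · exact h.append (Sublist.refl _)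
    · exact h.trans (sublist_append_left _ _)

theorem append_singleton_sublist_append_of_notMem {A : Type*} {x y z : List A} {a : A}
    (h : a ∉ z) : (x ++ [a]).Sublist (y ++ z) ↔ (x ++ [a]).Sublist y := by
  induction z using List.reverseRecOn with
  | nil => simp
  | append_singleton z b ih =>
    simp only [mem_append, mem_singleton, not_or] at h
    rw [← append_assoc, append_singleton_sublist_append_singleton, ih h.1]
    simp [h.2]

theorem sublist_of_append_singleton_sublist {A : Type*} {x y : List A} {a b : A}
    (h : (x ++ [a]).Sublist (y ++ [b])) : x.Sublist y := by
  rw [append_singleton_sublist_append_singleton] at h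
  rcases h with h | h
  · exact h.2
  · exact (sublist_append_left _ _).trans h

/-- A superword of `x ++ [a]` is cut at its last occurrence of `a`. -/
theorem exists_eq_append_cons_notMem {A : Type*} {x y : List A} {a : A}
    (h : (x ++ [a]).Sublist y) : ∃ y' z, y = y' ++ a :: z ∧ a ∉ z ∧ x.Sublist y' := by
  induction y using List.reverseRecOn with
  | nil => simp at h
  | append_singleton y b ih =>
    by_cases hab : a = b
    · subst hab
      exact ⟨y, [], by simp, by simp, sublist_of_append_singleton_sublist h⟩
    · rw [append_singleton_sublist_append_singleton] at h
      obtain ⟨y', z, rfl, hz, hx⟩ := ih (h.resolve_left fun h => hab h.1)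
      exact ⟨y', z ++ [b], by simp, by simp [hz, hab], hx⟩

/-- A superword of `x` has a prefix that is a minimal superword of `x`. -/
theorem exists_minimal_prefix {A : Type*} {x y : List A} (h : x.Sublist y) :
    ∃ y' z, y = y' ++ z ∧ KindRel .minSup x y' := by
  induction y using List.reverseRecOn with
  | nil => exact ⟨[], [], rfl, h, by simp⟩
  | append_singleton y b ih =>
    by_cases hx : x.Sublist y
    · obtain ⟨y', z, rfl, hy⟩ := ih hx
      exact ⟨y', z ++ [b], by simp, hy⟩
    · refine ⟨y ++ [b], [], by simp, h, ?_⟩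
      intro y' c hc
      have := List.append_inj' hc rfl
      rwa [← this.1]

theorem minimal_prefix_unique {A : Type*} {x y y' z z' : List A}
    (h : y ++ z = y' ++ z') (hy : KindRel .minSup x y)
    (hy' : KindRel .minSup x y') : y = y' ∧ z = z' := by
  have key : ∀ {y y' : List A}, KindRel .minSup x y → KindRel .minSup x y' →
      ∀ w, y' = y ++ w → w = [] := by
    intro y y' hy hy' w hw
    rcases List.eq_nil_or_concat' w with h | ⟨w', b, rfl⟩
    · exact h
    · exact absurd (hy.1.trans (sublist_append_left y w')) (hy'.2 (y ++ w') b (by simp [hw]))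
  rcases List.append_eq_append_iff.1 h with ⟨w, hw, hz⟩ | ⟨w, hw, hz⟩
  · have := key hy hy' w hw
    subst this; simp_all
  · have := key hy' hy w hw
    subst this; simp_all

theorem not_append_singleton_sublist_of_minimal {A : Type*} {x y : List A} {a : A}
    (h : KindRel .minSup x y) : ¬ (x ++ [a]).Sublist y := by
  intro hs
  rcases List.eq_nil_or_concat' y with rfl | ⟨w, b, rfl⟩
  · simp at hs
  · exact h.2 w b rfl (sublist_of_append_singleton_sublist hs)

theorem exists_kindRel_of_append_singleton {A : Type*} {x y : List A} {a : A} {t : Kind A}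
    (h : KindRel t (x ++ [a]) y) :
    ∃ t' y' z, y = y' ++ z ∧ KindRel t' x y' ∧ KindStep a t' t z := by
  rcases t with i | ⟨o, i⟩ | _ | _ | _
  · obtain ⟨h, hi⟩ := h
    obtain ⟨y', z, rfl, hz, hx⟩ := exists_eq_append_cons_notMem h
    have hl := hx.length_le
    simp only [length_append, length_cons, length_nil] at hi
    refine ⟨.sup ⟨min (y'.length - x.length) 2, by omega⟩, y', a :: z, rfl, ⟨hx, rfl⟩,
      z, rfl, hz, ?_⟩
    change min (min (y'.length - x.length) 2 + z.length) 2 = (i : ℕ)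
    omega
  · obtain ⟨h, ho, hi⟩ := h
    have hl := h.length_le
    simp only [length_append, length_cons, length_nil] at hi hl
    by_cases hx : y.Sublist x
    · refine ⟨.sub o ⟨min (x.length - y.length) 2, by omega⟩, y, [], by simp,
        ⟨hx, fun b hb hs => ho b hb (hs.trans (sublist_append_left _ _)), rfl⟩,
        .inr ⟨rfl, ?_, rfl, ?_⟩⟩
      · rintro rfl
        exact ho a rfl (hx.append (Sublist.refl _))
      · have := hx.length_le
        change min (min (x.length - y.length) 2 + 1) 2 = (i : ℕ)
        omega
    · rcases List.eq_nil_or_concat' y with rfl | ⟨w, b, rfl⟩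
      · simp at hx
      · rw [append_singleton_sublist_append_singleton] at h
        obtain ⟨rfl, h'⟩ := h.resolve_right hx
        refine ⟨.sub (some b) i, w, [b], rfl, ⟨h', ?_, ?_⟩, .inl ⟨rfl, rfl, rfl⟩⟩
        · rintro c hc
          cases hc
          exact hx
        · simp only [length_append, length_cons, length_nil] at hi
          omega
  · obtain ⟨h, hm⟩ := h
    rcases List.eq_nil_or_concat' y with rfl | ⟨w, b, rfl⟩
    · simp at h
    · have hw := hm w b rfl
      rw [append_singleton_sublist_append_singleton] at h
      obtain ⟨rfl, h'⟩ := h.resolve_right hw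
      obtain ⟨y', z, rfl, hy⟩ := exists_minimal_prefix h'
      refine ⟨.minSup, y', z ++ [a], by simp, hy, z, rfl, ?_⟩
      intro hz
      obtain ⟨z₁, z₂, rfl⟩ := List.append_of_mem hz
      apply hw
      exact hy.1.append (by simp)
  · obtain ⟨h, hm⟩ := h
    rcases List.eq_nil_or_concat' y with rfl | ⟨w, b, rfl⟩
    · simp at h
    · by_cases hw : x.Sublist w
      · obtain ⟨y', z, e, hy⟩ := exists_minimal_prefix (hw.trans (sublist_append_left w [b]))
        refine ⟨.minSup, y', z, e, hy, ?_, ?_⟩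
        · rintro rfl
          exact hy.2 w b (by simpa using e.symm) hw
        · intro hz
          obtain ⟨z₁, z₂, rfl⟩ := List.append_of_mem hz
          apply hm
          rw [e]
          exact hy.1.append (by simp)
      · refine ⟨.notSup, w, [b], rfl, ⟨?_, hw⟩, rfl⟩
        simpa using h
  · obtain ⟨h, hm⟩ := h
    rcases List.eq_nil_or_concat' y with rfl | ⟨w, b, rfl⟩
    · simp at hm
    · have hl : w.length < x.length := by simpa using h
      by_cases hw : w.Sublist x
      · rw [append_singleton_sublist_append_singleton, not_or] at hm
        refine ⟨.sub (some b) ⟨min (x.length - w.length) 2, by omega⟩, w, [b], rfl,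
          ⟨hw, ?_, rfl⟩, ?_, b, ?_, rfl, rfl⟩
        · rintro c hc
          cases hc
          exact hm.2
        · change 1 ≤ min (x.length - w.length) 2
          omega
        · rintro rfl
          exact hm.1 ⟨rfl, hw⟩
      · exact ⟨.notSub, w, [b], rfl, ⟨hl, hw⟩, rfl⟩

theorem KindRel.append {A : Type*} {x y z : List A} {a : A} {t t' : Kind A}
    (h : KindRel t' x y) (hs : KindStep a t' t z) : KindRel t (x ++ [a]) (y ++ z) := by
  rcases t with i | ⟨o, i⟩ | _ | _ | _ <;> rcases t' with j | ⟨p, j⟩ | _ | _ | _ <;>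
    simp only [KindStep] at hs
  · obtain ⟨z', rfl, hz, hi⟩ := hs
    obtain ⟨h, hj⟩ := h
    have := h.length_le
    refine ⟨h.append (by simp), ?_⟩
    simp only [length_append, length_cons, length_nil]
    omega
  · obtain ⟨h, hp, hj⟩ := h
    have := h.length_le
    rcases hs with ⟨rfl, rfl, rfl⟩ | ⟨rfl, hpa, rfl, hi⟩
    · refine ⟨h.append (Sublist.refl _), fun b _ hb => ?_, ?_⟩
      · exact hp a rfl (sublist_of_append_singleton_sublist hb)
      · simp only [length_append, length_cons, length_nil]
        omega
    · rw [append_nil]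
      refine ⟨h.trans (sublist_append_left _ _), fun b hb hs => ?_, ?_⟩
      · rw [append_singleton_sublist_append_singleton] at hs
        rcases hs with ⟨rfl, -⟩ | hs
        · exact hpa hb
        · exact hp b hb hs
      · simp only [length_append, length_cons, length_nil]
        omega
  · obtain ⟨z', rfl, hz⟩ := hs
    refine ⟨?_, ?_⟩
    · rw [← append_assoc]
      exact (h.1.trans (sublist_append_left _ _)).append (Sublist.refl _)
    · intro y' b hb hs
      rw [← append_assoc] at hb
      rw [← (List.append_inj' hb rfl).1, append_singleton_sublist_append_of_notMem hz] at hs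
      exact not_append_singleton_sublist_of_minimal h hs
  · obtain ⟨hz, hz'⟩ := hs
    refine ⟨?_, ?_⟩
    · have := h.1.length_le
      have := List.length_pos_iff.2 hz
      simp only [length_append, length_cons, length_nil]
      omega
    · rw [append_singleton_sublist_append_of_notMem hz']
      exact not_append_singleton_sublist_of_minimal h
  · obtain ⟨b, rfl⟩ := List.length_eq_one_iff.1 hs
    exact ⟨by simpa using h.1, fun hs => h.2 (sublist_of_append_singleton_sublist hs)⟩
  · obtain ⟨hj', b, hb, rfl, rfl⟩ := hs
    obtain ⟨h, hp, hj⟩ := h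
    refine ⟨?_, fun hs => ?_⟩
    · simp only [length_append, length_cons, length_nil]
      omega
    · rw [append_singleton_sublist_append_singleton] at hs
      rcases hs with ⟨rfl, -⟩ | hs
      · exact hb rfl
      · exact hp b rfl hs
  · obtain ⟨b, rfl⟩ := List.length_eq_one_iff.1 hs
    exact ⟨by simpa using h.1, fun hs => h.2 (sublist_of_append_singleton_sublist hs)⟩

theorem append_cons_inj_of_notMem {A : Type*} {x y z w : List A} {a : A} (hz : a ∉ z)
    (hw : a ∉ w) (h : x ++ a :: z = y ++ a :: w) : x = y ∧ z = w := by
  rcases List.append_eq_append_iff.1 h with ⟨u, hu, hv⟩ | ⟨u, hu, hv⟩ <;> rcases u with _ | ⟨b, u⟩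
  · simp_all
  · simp only [cons_append, cons.injEq] at hv
    exact absurd (by rw [hv.2]; simp) hz
  · simp_all
  · simp only [cons_append, cons.injEq] at hv
    exact absurd (by rw [hv.2]; simp) hw

theorem kindStep_unique {A : Type*} {x y₁ y₂ z₁ z₂ : List A} {a : A} {t t₁ t₂ : Kind A}
    (h : y₁ ++ z₁ = y₂ ++ z₂) (h₁ : KindRel t₁ x y₁) (h₂ : KindRel t₂ x y₂)
    (s₁ : KindStep a t₁ t z₁) (s₂ : KindStep a t₂ t z₂) : t₁ = t₂ ∧ y₁ = y₂ ∧ z₁ = z₂ := by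
  have mixed : ∀ {y y' z z' : List A}, y ++ z = y' ++ z' → KindRel .minSup x y → z ≠ [] →
      KindRel .notSup x y' → z'.length = 1 → False := by
    intro y y' z z' h hy hz hy' hz'
    apply hy'.2
    refine hy.1.trans (List.prefix_of_prefix_length_le (l₃ := y ++ z) (by simp) (by simp [h])
      ?_).sublist
    have := congrArg length h
    have := List.length_pos_iff.2 hz
    simp only [length_append] at *
    omega
  have mixed' : ∀ {y y' z z' : List A} {o : Option A} {j : Fin 3}, y ++ z = y' ++ z' →
      KindRel (.sub o j) x y → z.length = 1 →
      KindRel .notSub x y' → z'.length = 1 → False := by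
    intro y y' z z' o j h hy hz hy' hz'
    have := (List.append_inj' h (by simp [hz, hz'])).1
    subst this
    exact hy'.2 hy.1
  rcases t with i | ⟨o, i⟩ | _ | _ | _ <;> rcases t₁ with j₁ | ⟨o₁, j₁⟩ | _ | _ | _ <;>
    simp only [KindStep] at s₁ <;> rcases t₂ with j₂ | ⟨o₂, j₂⟩ | _ | _ | _ <;>
    simp only [KindStep] at s₂
  · obtain ⟨w₁, rfl, hw₁, -⟩ := s₁
    obtain ⟨w₂, rfl, hw₂, -⟩ := s₂
    obtain ⟨rfl, rfl⟩ := append_cons_inj_of_notMem hw₁ hw₂ h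
    refine ⟨?_, rfl, rfl⟩
    rw [Fin.ext (h₁.2.symm.trans h₂.2)]
  · obtain ⟨g₁, e₁, l₁⟩ := h₁
    obtain ⟨g₂, e₂, l₂⟩ := h₂
    rcases s₁ with ⟨rfl, rfl, rfl⟩ | ⟨rfl, ho₁, rfl, -⟩ <;>
      rcases s₂ with ⟨rfl, rfl, rfl⟩ | ⟨rfl, ho₂, rfl, -⟩
    · exact ⟨rfl, (List.append_inj' h rfl).1, rfl⟩
    · exact absurd (by rw [h]; simpa using g₂) (e₁ a rfl)
    · exact absurd (by rw [← h]; simpa using g₁) (e₂ a rfl)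
    · have : y₁ = y₂ := by simpa using h
      subst this
      refine ⟨?_, rfl, rfl⟩
      rw [Fin.ext (l₁.symm.trans l₂)]
  · exact ⟨rfl, minimal_prefix_unique h h₁ h₂⟩
  · exact ⟨rfl, minimal_prefix_unique h h₁ h₂⟩
  · exact (mixed h h₁ s₁.1 h₂ s₂).elim
  · exact (mixed h.symm h₂ s₂.1 h₁ s₁).elim
  · exact ⟨rfl, List.append_inj' h (Eq.trans s₁ (Eq.symm s₂))⟩
  · obtain ⟨-, b₁, -, rfl, rfl⟩ := s₁
    obtain ⟨-, b₂, -, rfl, rfl⟩ := s₂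
    obtain ⟨rfl, e⟩ := List.append_inj' h rfl
    cases e
    refine ⟨?_, rfl, rfl⟩
    rw [Fin.ext (h₁.2.2.symm.trans h₂.2.2)]
  · obtain ⟨-, b₁, -, rfl, rfl⟩ := s₁
    exact (mixed' h h₁ rfl h₂ s₂).elim
  · obtain ⟨-, b₂, -, rfl, rfl⟩ := s₂
    exact (mixed' h.symm h₂ rfl h₁ s₁).elim
  · exact ⟨rfl, List.append_inj' h (Eq.trans s₁ (Eq.symm s₂))⟩

/-! ### Counting related words -/

/-- The kinds as a sum type, which gives their number. -/
def Kind.equivSum (A : Type*) : Kind A ≃ Fin 3 ⊕ (Option A × Fin 3) ⊕ Fin 3 where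
  toFun
    | .sup i => .inl i
    | .sub o i => .inr (.inl (o, i))
    | .minSup => .inr (.inr 0)
    | .notSup => .inr (.inr 1)
    | .notSub => .inr (.inr 2)
  invFun
    | .inl i => .sup i
    | .inr (.inl (o, i)) => .sub o i
    | .inr (.inr 0) => .minSup
    | .inr (.inr 1) => .notSup
    | .inr (.inr 2) => .notSub
  left_inv t := by cases t <;> rfl
  right_inv t := by
    rcases t with i | ⟨o, i⟩ | i
    · rfl
    · rfl
    · fin_cases i <;> rfl

instance {A : Type*} [Finite A] : Finite (Kind A) := Finite.of_equiv _ (Kind.equivSum A).symm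

theorem Kind.card_eq (A : Type*) [Finite A] : Nat.card (Kind A) = 3 * Nat.card A + 9 := by
  rw [Nat.card_congr (Kind.equivSum A)]
  simp only [Nat.card_sum, Nat.card_prod, Finite.card_option, Nat.card_fin]
  ring

/-- The kernel of `f` is a right congruence, i.e. `f` maps a word to the state that some
deterministic automaton reaches on it. -/
def RightCongr {A σ : Type*} (f : List A → σ) : Prop :=
  ∀ u v a, f u = f v → f (u ++ [a]) = f (v ++ [a])

theorem RightCongr.append {A σ : Type*} {f : List A → σ} (hf : RightCongr f) {u v : List A}
    (h : f u = f v) (z : List A) : f (u ++ z) = f (v ++ z) := by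
  induction z using List.reverseRecOn with
  | nil => simpa using h
  | append_singleton z a ih =>
    rw [← append_assoc, ← append_assoc]
    exact hf _ _ a ih

/-- The number of words of class `p.2` that are related to `x` by the kind `p.1`. -/
noncomputable def kindCount {A σ : Type*} (f : List A → σ) (x : List A) (p : Kind A × σ) : ℕ∞ :=
  {y | KindRel p.1 x y ∧ f y = p.2}.encard

/-- The number of factors `z` with `KindStep a p.1 p'.1 z` that lead from the class `p.2` to the
class `p'.2`. The element `u` is a representative of the class `p.2`; its choice is immaterial. -/
noncomputable def stepCount {A σ : Type*} (f : List A → σ) (a : A) (p p' : Kind A × σ) : ℕ∞ :=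
  {z | KindStep a p.1 p'.1 z ∧ ∃ u, f u = p.2 ∧ f (u ++ z) = p'.2}.encard

/-- The counts for `x ++ [a]` depend linearly, with coefficients in `ℕ∞`, on those for `x`. -/
theorem kindCount_append_singleton {A σ : Type*} [Fintype (Kind A × σ)] {f : List A → σ}
    (hf : RightCongr f) (x : List A) (a : A) (p : Kind A × σ) :
    kindCount f (x ++ [a]) p = ∑ p', kindCount f x p' * stepCount f a p' p := by
  -- The pairs `(y', z)` whose products are the words counted on the left.
  let S : Kind A × σ → Set (List A × List A) := fun p' =>
    {y | KindRel p'.1 x y ∧ f y = p'.2} ×ˢ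
      {z | KindStep a p'.1 p.1 z ∧ ∃ u, f u = p'.2 ∧ f (u ++ z) = p.2}
  have hS : ∀ p', (S p').encard = kindCount f x p' * stepCount f a p' p :=
    fun p' => Set.encard_prod
  have hinj : ∀ p', Set.InjOn (fun q : List A × List A => q.1 ++ q.2) (S p') := by
    rintro p' ⟨y₁, z₁⟩ h₁ ⟨y₂, z₂⟩ h₂ h
    obtain ⟨-, h, h'⟩ := kindStep_unique h h₁.1.1 h₂.1.1 h₁.2.1 h₂.2.1
    exact Prod.ext h h'
  have hU : {y | KindRel p.1 (x ++ [a]) y ∧ f y = p.2} =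
      ⋃ p', (fun q : List A × List A => q.1 ++ q.2) '' S p' := by
    ext y
    simp only [Set.mem_ofPred_eq, Set.mem_iUnion, Set.mem_image, Prod.exists]
    constructor
    · rintro ⟨h, hy⟩
      obtain ⟨t', y', z, rfl, hy', hz⟩ := exists_kindRel_of_append_singleton h
      exact ⟨t', f y', y', z, ⟨⟨hy', rfl⟩, hz, y', rfl, hy⟩, rfl⟩
    · rintro ⟨t', s, y', z, ⟨⟨hy', rfl⟩, hz, u, hu, hs⟩, rfl⟩
      exact ⟨hy'.append hz, by rw [← hs]; exact hf.append hu.symm z⟩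
  have hd : Pairwise (Function.onFun _root_.Disjoint
      fun p' => (fun q : List A × List A => q.1 ++ q.2) '' S p') := by
    intro p₁ p₂ hne
    refine Set.disjoint_left.2 ?_
    rintro _ ⟨⟨y₁, z₁⟩, h₁, rfl⟩ ⟨⟨y₂, z₂⟩, h₂, h⟩
    obtain ⟨e₁, e₂, -⟩ := kindStep_unique h h₂.1.1 h₁.1.1 h₂.2.1 h₁.2.1
    apply hne
    refine Prod.ext e₁.symm ?_
    rw [← h₁.1.2, ← h₂.1.2]
    exact congrArg f e₂.symm
  rw [kindCount, hU, Set.encard_iUnion_of_finite hd, finsum_eq_sum_of_fintype]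
  refine Finset.sum_congr rfl fun p' _ => ?_
  rw [(hinj p').encard_image, hS]

/-- Equality of cardinalities up to the threshold `t` and modulo `q`: the infinite cardinality is
equivalent to itself only. For `1 ≤ t` this is a semiring congruence on `ℕ∞`. -/
def CountEq (t q : ℕ) (a b : ℕ∞) : Prop :=
  a = b ∨ ∃ m n : ℕ, a = m ∧ b = n ∧ t ≤ m ∧ t ≤ n ∧ m ≡ n [MOD q]

theorem CountEq.add {t q : ℕ} {a b a' b' : ℕ∞} (h : CountEq t q a b) (h' : CountEq t q a' b') :
    CountEq t q (a + a') (b + b') := by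
  have hr : ∀ {a b : ℕ∞} (c : ℕ∞), CountEq t q a b → CountEq t q (a + c) (b + c) := by
    rintro a b c (rfl | ⟨m, n, rfl, rfl, hm, hn, hmn⟩)
    · exact .inl rfl
    · induction c using ENat.recTopCoe with
      | top => simp [CountEq]
      | coe c =>
        exact .inr ⟨m + c, n + c, by simp, by simp, by omega, by omega, hmn.add_right c⟩
  have ht : ∀ {a b c : ℕ∞}, CountEq t q a b → CountEq t q b c → CountEq t q a c := by
    rintro a b c (rfl | ⟨m, n, rfl, rfl, hm, hn, hmn⟩) (rfl | ⟨m', n', h, rfl, hm', hn', hmn'⟩)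
    · exact .inl rfl
    · exact .inr ⟨m', n', h, rfl, hm', hn', hmn'⟩
    · exact .inr ⟨m, n, rfl, rfl, hm, hn, hmn⟩
    · rw [Nat.cast_inj] at h
      subst h
      exact .inr ⟨m, n', rfl, rfl, hm, hn', hmn.trans hmn'⟩
  have := hr b h'
  rw [add_comm a' b, add_comm b' b] at this
  exact ht (hr a' h) this

theorem CountEq.mul_right {t q : ℕ} (ht : 1 ≤ t) {a b : ℕ∞} (h : CountEq t q a b) (c : ℕ∞) :
    CountEq t q (a * c) (b * c) := by
  rcases h with rfl | ⟨m, n, rfl, rfl, hm, hn, hmn⟩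
  · exact .inl rfl
  · induction c using ENat.recTopCoe with
    | top =>
      -- Both factors are nonzero because of `1 ≤ t`.
      left
      rw [ENat.mul_top (by simp; omega), ENat.mul_top (by simp; omega)]
    | coe c =>
      rcases Nat.eq_zero_or_pos c with rfl | hc
      · simp [CountEq]
      · exact .inr ⟨m * c, n * c, by simp, by simp, hm.trans (Nat.le_mul_of_pos_right m hc),
          hn.trans (Nat.le_mul_of_pos_right n hc), hmn.mul_right c⟩

theorem CountEq.sum {t q : ℕ} {ι : Type*} (s : Finset ι) {a b : ι → ℕ∞}
    (h : ∀ i, CountEq t q (a i) (b i)) : CountEq t q (∑ i ∈ s, a i) (∑ i ∈ s, b i) := by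
  classical
  induction s using Finset.induction_on with
  | empty => simp [CountEq]
  | insert i s hi ih =>
    rw [Finset.sum_insert hi, Finset.sum_insert hi]
    exact (h i).add ih

/-- The class of a cardinality modulo `CountEq t q`, as a number that is at most `t + q`; the value
`t + q` is that of `⊤`. -/
noncomputable def countClass (t q : ℕ) (a : ℕ∞) : ℕ :=
  ENat.recTopCoe (C := fun _ => ℕ) (t + q) (fun m => if m < t then m else t + (m - t) % q) a

theorem countClass_natCast (t q m : ℕ) :
    countClass t q m = if m < t then m else t + (m - t) % q := rfl

theorem countClass_lt {t q : ℕ} (hq : 1 ≤ q) (a : ℕ∞) : countClass t q a < t + q + 1 := by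
  induction a using ENat.recTopCoe with
  | top => exact Nat.lt_succ_self _
  | coe m =>
    have := Nat.mod_lt (m - t) hq
    rw [countClass_natCast]
    split_ifs <;> omega

theorem countEq_of_countClass_eq {t q : ℕ} (hq : 1 ≤ q) {a b : ℕ∞}
    (h : countClass t q a = countClass t q b) : CountEq t q a b := by
  have hlt := fun n => Nat.mod_lt n hq
  have key : ∀ m : ℕ, countClass t q m ≠ t + q := by
    intro m
    have := hlt (m - t)
    rw [countClass_natCast]
    split_ifs <;> omega
  have htop : countClass t q ⊤ = t + q := rfl
  induction a using ENat.recTopCoe with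
  | top =>
    induction b using ENat.recTopCoe with
    | top => exact .inl rfl
    | coe n => exact absurd (h.symm.trans htop) (key n)
  | coe m =>
    induction b using ENat.recTopCoe with
    | top => exact absurd (h.trans htop) (key m)
    | coe n =>
      rw [countClass_natCast, countClass_natCast] at h
      split_ifs at h with h₁ h₂ h₂
      · exact .inl (by rw [h])
      · omega
      · omega
      · refine .inr ⟨m, n, rfl, rfl, by omega, by omega, ?_⟩
        have h' : m - t ≡ n - t [MOD q] := by unfold Nat.ModEq; omega
        have := h'.add_right t
        rwa [Nat.sub_add_cancel (by omega), Nat.sub_add_cancel (by omega)] at this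

theorem CountEq.countClass_eq {t q : ℕ} {a b : ℕ∞} (h : CountEq t q a b) :
    countClass t q a = countClass t q b := by
  rcases h with rfl | ⟨m, n, rfl, rfl, hm, hn, hmn⟩
  · rfl
  · rw [countClass_natCast, countClass_natCast, if_neg (by omega), if_neg (by omega)]
    have : m - t + t ≡ n - t + t [MOD q] := by
      rwa [Nat.sub_add_cancel hm, Nat.sub_add_cancel hn]
    rw [Nat.ModEq.add_right_cancel' t this]

/-! ### Relations recognized by right congruences -/

theorem exists_between_of_sublist {A : Type*} {u w : List A} (h : u.Sublist w)
    (hl : u.length < w.length) : ∃ v, u.Sublist v ∧ v.Sublist w ∧ v.length = u.length + 1 := by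
  induction h with
  | slnil => simp at hl
  | @cons u w a h ih =>
    rcases h.length_le.lt_or_eq with h' | h'
    · obtain ⟨v, h₁, h₂, h₃⟩ := ih h'
      exact ⟨v, h₁, h₂.cons a, h₃⟩
    · exact ⟨a :: w, h.cons a, Sublist.refl _, by simp [h']⟩
  | @cons_cons u w a h ih =>
    obtain ⟨v, h₁, h₂, h₃⟩ := ih (by simpa using hl)
    exact ⟨a :: v, h₁.cons_cons a, h₂.cons_cons a, by simp [h₃]⟩

theorem covers_iff {A : Type*} {u w : List A} :
    Covers u w ↔ u.Sublist w ∧ w.length = u.length + 1 := by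
  have hlt : ∀ {u w : List A}, ProperSubword u w → u.length < w.length := fun h =>
    lt_of_le_of_ne h.1.length_le fun h' => h.2 (h.1.eq_of_length h')
  constructor
  · rintro ⟨h, hn⟩
    refine ⟨h.1, ?_⟩
    obtain ⟨v, h₁, h₂, h₃⟩ := exists_between_of_sublist h.1 (hlt h)
    by_contra hc
    have := h₂.length_le
    refine hn ⟨v, ⟨h₁, ?_⟩, h₂, ?_⟩
    · rintro rfl; omega
    · rintro rfl; omega
  · rintro ⟨h, hl⟩
    refine ⟨⟨h, by rintro rfl; omega⟩, ?_⟩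
    rintro ⟨v, h₁, h₂⟩
    have := hlt h₁
    have := hlt h₂
    omega

/-- The pairs `(x, y)` and `(x', y')` satisfy the same atomic formulas without constants and
automata. -/
def SameType {A : Type*} (x y x' y' : List A) : Prop :=
  (x.Sublist y ↔ x'.Sublist y') ∧ (y.Sublist x ↔ y'.Sublist x') ∧
    (Covers x y ↔ Covers x' y') ∧ (Covers y x ↔ Covers y' x')

/-- The kinds that partition the pairs of words; each of them determines the type (`SameType`) of a
pair. -/
def Kind.IsPrincipal {A : Type*} : Kind A → Prop
  | .sup _ => True
  | .sub o i => o = none ∧ i ≠ 0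
  | .minSup => False
  | .notSup => True
  | .notSub => True

theorem exists_principal {A : Type*} (x y : List A) :
    ∃ t : Kind A, t.IsPrincipal ∧ KindRel t x y := by
  by_cases h : x.Sublist y
  · exact ⟨.sup ⟨min (y.length - x.length) 2, by omega⟩, trivial, h, rfl⟩
  by_cases h' : y.Sublist x
  · refine ⟨.sub none ⟨min (x.length - y.length) 2, by omega⟩, ⟨rfl, ?_⟩, h', by simp, rfl⟩
    intro he
    have := congrArg Fin.val he
    simp only [Fin.val_zero] at this
    have := h'.length_le
    exact h (h'.eq_of_length (by omega) ▸ Sublist.refl _)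
  rcases le_or_gt x.length y.length with hl | hl
  · exact ⟨.notSup, trivial, hl, h⟩
  · exact ⟨.notSub, trivial, hl, h'⟩

theorem principal_unique {A : Type*} {x y : List A} {t t' : Kind A} (ht : t.IsPrincipal)
    (ht' : t'.IsPrincipal) (h : KindRel t x y) (h' : KindRel t' x y) : t = t' := by
  rcases t with i | ⟨o, i⟩ | _ | _ | _ <;> rcases t' with j | ⟨p, j⟩ | _ | _ | _ <;>
    simp only [Kind.IsPrincipal, KindRel] at ht ht' h h' <;> try rfl
  · rw [Fin.ext (h.2.symm.trans h'.2)]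
  · have := h.1.length_le
    have := h'.1.length_le
    have : (j : ℕ) ≠ 0 := fun h => ht'.2 (Fin.ext h)
    omega
  · exact absurd h.1 h'.2
  · have := h.1.length_le
    omega
  · have := h.1.length_le
    have := h'.1.length_le
    have : (i : ℕ) ≠ 0 := fun h => ht.2 (Fin.ext h)
    omega
  · rw [ht.1, ht'.1, Fin.ext (h.2.2.symm.trans h'.2.2)]
  · have := h.1.length_le
    have : (i : ℕ) ≠ 0 := fun h => ht.2 (Fin.ext h)
    omega
  · exact absurd h.1 h'.2
  · exact absurd h'.1 h.2
  · have := h'.1.length_le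
    have : (j : ℕ) ≠ 0 := fun h => ht'.2 (Fin.ext h)
    omega
  · omega
  · have := h'.1.length_le
    omega
  · exact absurd h'.1 h.2
  · omega

theorem sameType_of_principal {A : Type*} {x y x' y' : List A} {t : Kind A} (ht : t.IsPrincipal)
    (h : KindRel t x y) (h' : KindRel t x' y') : SameType x y x' y' := by
  have key : ∀ {u v : List A}, u.Sublist v → (v.Sublist u ↔ u.length = v.length) := fun h =>
    ⟨fun h' => le_antisymm h.length_le h'.length_le, fun h' => h.eq_of_length h' ▸ Sublist.refl _⟩
  rcases t with i | ⟨o, i⟩ | _ | _ | _ <;> simp only [Kind.IsPrincipal, KindRel] at ht h h'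
  · simp only [SameType, covers_iff, h.1, h'.1, key h.1, key h'.1, true_and]
    have := h.1.length_le
    have := h'.1.length_le
    omega
  · simp only [SameType, covers_iff, h.1, h'.1, key h.1, key h'.1, true_and]
    have := h.1.length_le
    have := h'.1.length_le
    omega
  · have g : ¬ y.Sublist x := fun hs => h.2 (hs.eq_of_length (le_antisymm hs.length_le h.1) ▸
      Sublist.refl _)
    have g' : ¬ y'.Sublist x' := fun hs =>
      h'.2 (hs.eq_of_length (le_antisymm hs.length_le h'.1) ▸ Sublist.refl _)
    simp [SameType, covers_iff, h.2, h'.2, g, g']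
  · have g : ¬ x.Sublist y := fun hs => absurd hs.length_le (by omega)
    have g' : ¬ x'.Sublist y' := fun hs => absurd hs.length_le (by omega)
    simp [SameType, covers_iff, h.2, h'.2, g, g']

/-- If the truth of `Q x y` depends only on the classes of `x` and `y` and on the type of the pair,
then the number of `y` with `Q x y` is a sum of numbers `kindCount f x p`, where the set of
summands depends only on the class of `x`. -/
theorem encard_eq_sum_kindCount {A σ : Type*} [Fintype (Kind A × σ)] {f : List A → σ}
    {Q : List A → List A → Prop}
    (hQ : ∀ x y x' y', f x = f x' → f y = f y' → SameType x y x' y' → Q x y → Q x' y') :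
    ∃ g : σ → Kind A × σ → Prop, ∀ x, {y | Q x y}.encard =
      ∑ p, {y | g (f x) p ∧ KindRel p.1 x y ∧ f y = p.2}.encard := by
  -- A summand is selected if some, equivalently every, pair with these classes and this principal
  -- kind satisfies `Q`.
  refine ⟨fun d p => p.1.IsPrincipal ∧ ∃ x y, f x = d ∧ f y = p.2 ∧ KindRel p.1 x y ∧ Q x y,
    fun x => ?_⟩
  rw [← finsum_eq_sum_of_fintype, ← Set.encard_iUnion_of_finite]
  · congr 1
    ext y
    simp only [Set.mem_ofPred_eq, Set.mem_iUnion, Prod.exists]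
    constructor
    · intro h
      obtain ⟨t, ht, hr⟩ := exists_principal x y
      exact ⟨t, f y, ⟨ht, x, y, rfl, rfl, hr, h⟩, hr, rfl⟩
    · rintro ⟨t, s, ⟨ht, x', y', hx, hy, hr, h⟩, hr', hs⟩
      exact hQ x' y' x y hx (hy.trans hs.symm) (sameType_of_principal ht hr hr') h
  · intro p p' hne
    refine Set.disjoint_left.2 ?_
    rintro y ⟨⟨hp, -⟩, hr, hs⟩ ⟨⟨hp', -⟩, hr', hs'⟩
    exact hne (Prod.ext (principal_unique hp hp' hr hr') (hs.symm.trans hs'))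

/-- The relation `Q` is determined by a right congruence with at most `N` classes: whether `Q x y`
holds depends only on the classes of `x` and `y` and on the type of the pair `(x, y)`. -/
def Recog {A : Type*} (N : ℕ) (Q : List A → List A → Prop) : Prop :=
  ∃ f : List A → Fin N, RightCongr f ∧
    ∀ x y x' y', f x = f x' → f y = f y' → SameType x y x' y' → Q x y → Q x' y'

theorem Recog.of_finite {A σ : Type*} [Finite σ] {N : ℕ} (hN : Nat.card σ ≤ N)
    {Q : List A → List A → Prop} {f : List A → σ} (hf : RightCongr f)
    (hQ : ∀ x y x' y', f x = f x' → f y = f y' → SameType x y x' y' → Q x y → Q x' y') :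
    Recog N Q := by
  let e : σ → Fin N := fun s => Fin.castLE hN (Finite.equivFin σ s)
  have he : Function.Injective e :=
    (Fin.castLE_injective hN).comp (Finite.equivFin σ).injective
  exact ⟨e ∘ f, fun u v a h => congrArg e (hf u v a (he h)),
    fun x y x' y' hx hy => hQ x y x' y' (he hx) (he hy)⟩

theorem Recog.mono {A : Type*} {N N' : ℕ} {Q : List A → List A → Prop} (h : Recog N Q)
    (hN : N ≤ N') : Recog N' Q := by
  obtain ⟨f, hf, hQ⟩ := h
  exact .of_finite (by simpa using hN) hf hQ

theorem Recog.not {A : Type*} {N : ℕ} {Q : List A → List A → Prop} (h : Recog N Q) :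
    Recog N fun x y => ¬ Q x y := by
  obtain ⟨f, hf, hQ⟩ := h
  refine ⟨f, hf, fun x y x' y' hx hy ht h h' => h (hQ x' y' x y hx.symm hy.symm ?_ h')⟩
  exact ⟨ht.1.symm, ht.2.1.symm, ht.2.2.1.symm, ht.2.2.2.symm⟩

theorem Recog.swap {A : Type*} {N : ℕ} {Q : List A → List A → Prop} (h : Recog N Q) :
    Recog N fun x y => Q y x := by
  obtain ⟨f, hf, hQ⟩ := h
  exact ⟨f, hf, fun x y x' y' hx hy ht =>
    hQ y x y' x' hy hx ⟨ht.2.1, ht.1, ht.2.2.2, ht.2.2.1⟩⟩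

theorem Recog.and {A : Type*} {N N' : ℕ} {Q Q' : List A → List A → Prop} (h : Recog N Q)
    (h' : Recog N' Q') : Recog (N * N') fun x y => Q x y ∧ Q' x y := by
  obtain ⟨f, hf, hQ⟩ := h
  obtain ⟨f', hf', hQ'⟩ := h'
  refine .of_finite (f := fun x => (f x, f' x)) (by simp) (fun u v a h => ?_) ?_
  · simp only [Prod.mk.injEq] at h ⊢
    exact ⟨hf _ _ a h.1, hf' _ _ a h.2⟩
  · intro x y x' y' hx hy ht h
    simp only [Prod.mk.injEq] at hx hy
    exact ⟨hQ x y x' y' hx.1 hy.1 ht h.1, hQ' x y x' y' hx.2 hy.2 ht h.2⟩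

theorem Recog.of_sameType {A : Type*} {Q : List A → List A → Prop}
    (hQ : ∀ x y x' y', SameType x y x' y' → Q x y → Q x' y') : Recog 1 Q :=
  ⟨fun _ => 0, fun _ _ _ _ => rfl, fun x y x' y' _ _ => hQ x y x' y'⟩

theorem Recog.of_rightCongr {A σ : Type*} [Finite σ] {N : ℕ} (hN : Nat.card σ ≤ N)
    {R : List A → Prop} {f : List A → σ} (hf : RightCongr f)
    (hR : ∀ x x', f x = f x' → R x → R x') : Recog N fun _ y => R y :=
  .of_finite hN hf fun _ y _ y' _ hy _ => hR y y' hy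

/-- Counting quantifiers preserve recognizability. The new right congruence remembers, besides the
old class of `x`, all numbers `kindCount f x p` up to `CountEq t q`; linearity of the counts
makes this a right congruence. -/
theorem Recog.count {A : Type*} [Finite A] {N : ℕ} {Q : List A → List A → Prop}
    (h : Recog N Q) {t q : ℕ} (ht : 1 ≤ t) (hq : 1 ≤ q) {S : ℕ∞ → Prop}
    (hS : ∀ m n, CountEq t q m n → S m → S n) :
    Recog (N * (t + q + 1) ^ ((3 * Nat.card A + 9) * N)) fun x _ => S {y | Q x y}.encard := by
  obtain ⟨f, hf, hQ⟩ := h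
  have := Fintype.ofFinite (Kind A)
  -- The vector of all counts, up to `CountEq t q`.
  let g : List A → (Kind A × Fin N → Fin (t + q + 1)) := fun x p =>
    ⟨countClass t q (kindCount f x p), countClass_lt hq _⟩
  have hg : ∀ {x x'}, g x = g x' → ∀ p, CountEq t q (kindCount f x p) (kindCount f x' p) :=
    fun h p => countEq_of_countClass_eq hq (congrArg Fin.val (congrFun h p))
  obtain ⟨r, hr⟩ := encard_eq_sum_kindCount hQ
  refine .of_finite (f := fun x => (f x, g x)) ?_ (fun u v a h => ?_) ?_
  · rw [Nat.card_prod, Nat.card_fun, Nat.card_prod, Kind.card_eq, Nat.card_fin, Nat.card_fin]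
  · simp only [Prod.mk.injEq] at h ⊢
    refine ⟨hf _ _ a h.1, funext fun p => Fin.ext ?_⟩
    refine CountEq.countClass_eq ?_
    rw [kindCount_append_singleton hf, kindCount_append_singleton hf]
    exact CountEq.sum _ fun p' => (hg h.2 p').mul_right ht _
  · intro x _ x' _ hx _ _ h
    simp only [Prod.mk.injEq] at hx
    refine hS _ _ ?_ h
    rw [hr, hr, ← hx.1]
    refine CountEq.sum _ fun p => ?_
    by_cases hp : r (f x) p
    · simpa [hp, kindCount] using hg hx.2 p
    · simp [hp, CountEq]

/-! ### Leftmost embeddings and pumping -/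

/-- One step of the leftmost embedding: the remaining word `r` loses its first letter if this is
`c`. -/
def matchLetter {A : Type*} [DecidableEq A] (r : List A) (c : A) : List A :=
  if r.head? = some c then r.tail else r

/-- The part of `x` that remains after as much of `x` as possible has been embedded into `y`, letter
by letter from the left. -/
def unmatched {A : Type*} [DecidableEq A] (x y : List A) : List A :=
  y.foldl matchLetter x

theorem sublist_cons_iff_matchLetter {A : Type*} [DecidableEq A] (x y : List A) (c : A) :
    x.Sublist (c :: y) ↔ (matchLetter x c).Sublist y := by
  rcases x with _ | ⟨b, x⟩
  · simp [matchLetter]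
  · by_cases hb : b = c
    · subst hb
      simp [matchLetter]
    · simp only [matchLetter, head?_cons, Option.some.injEq, hb, if_false]
      rw [List.cons_sublist_cons']
      simp [hb]

theorem sublist_append_iff_unmatched {A : Type*} [DecidableEq A] (x y z : List A) :
    x.Sublist (y ++ z) ↔ (unmatched x y).Sublist z := by
  induction y generalizing x with
  | nil => rfl
  | cons c y ih =>
    rw [cons_append, sublist_cons_iff_matchLetter, ih]
    rfl

theorem sublist_iff_unmatched {A : Type*} [DecidableEq A] (x y : List A) :
    x.Sublist y ↔ unmatched x y = [] := by
  have := sublist_append_iff_unmatched x y []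
  rwa [append_nil, sublist_nil] at this

theorem unmatched_suffix {A : Type*} [DecidableEq A] (x y : List A) : unmatched x y <:+ x := by
  induction y generalizing x with
  | nil => exact suffix_rfl
  | cons c y ih =>
    refine (ih (matchLetter x c)).trans ?_
    unfold matchLetter
    split_ifs
    · exact tail_suffix x
    · exact suffix_rfl

/-- For words `y` much longer than `x`, the type of `(x, y)` is determined by whether `x` is a
subword of `y`. -/
theorem sameType_of_length_le {A : Type*} {x y y' : List A} (hy : x.length + 2 ≤ y.length)
    (hy' : x.length + 2 ≤ y'.length) (h : x.Sublist y ↔ x.Sublist y') : SameType x y x y' := by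
  have g : ¬ y.Sublist x := fun hs => absurd hs.length_le (by omega)
  have g' : ¬ y'.Sublist x := fun hs => absurd hs.length_le (by omega)
  refine ⟨h, by simp [g, g'], ?_, by simp [covers_iff, g, g']⟩
  rw [covers_iff, covers_iff]
  omega

/-- Pumping for the set of all `y` with `Q x y`. The pumped factor lies beyond the first `x.length +
2` letters of `y`, so that only the class of `y` and the unmatched part of `x` matter. -/
theorem Recog.exists_pump {A : Type*} {N B : ℕ} {Q : List A → List A → Prop} (h : Recog N Q)
    {x y : List A} (hB : x.length + 2 + N * (x.length + 1) ≤ B) (hy : Q x y)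
    (hl : B ≤ y.length) :
    (∃ y', Q x y' ∧ y.length < y'.length) ∧
      ∃ y', Q x y' ∧ y'.length < y.length ∧ y.length ≤ y'.length + B := by
  classical
  obtain ⟨f, hf, hQ⟩ := h
  -- Pigeonhole for the prefixes `p i` of `y` of length at least `x.length + 2`: two of them agree in
  -- their class and in the unmatched part of `x`, which is determined by its length.
  let p : ℕ → List A := fun i => y.take (x.length + 2 + i)
  let g : Fin (N * (x.length + 1) + 1) → Fin N × Fin (x.length + 1) := fun i =>
    (f (p i), ⟨(unmatched x (p i)).length, Nat.lt_succ_of_le (unmatched_suffix x _).length_le⟩)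
  obtain ⟨i, j, hij, hg⟩ : ∃ i j, i < j ∧ g i = g j := by
    obtain ⟨i, j, hij, hg⟩ := Fintype.exists_ne_map_eq_of_card_lt g (by simp)
    rcases lt_or_gt_of_ne hij with h | h
    · exact ⟨i, j, h, hg⟩
    · exact ⟨j, i, h, hg.symm⟩
  have hj := j.2
  have hij' : (i : ℕ) < j := hij
  simp only [g, Prod.mk.injEq, Fin.mk.injEq] at hg
  have hun : unmatched x (p i) = unmatched x (p j) := by
    have h₁ := List.suffix_iff_eq_drop.1 (unmatched_suffix x (p i))
    have h₂ := List.suffix_iff_eq_drop.1 (unmatched_suffix x (p j))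
    rw [h₁, h₂, hg.2]
  have hli : (p i).length = x.length + 2 + i := by simp [p]; omega
  have hlj : (p j).length = x.length + 2 + j := by simp [p]; omega
  have key : ∀ {u₁ u₂ : List A} (w : List A), f u₁ = f u₂ → unmatched x u₁ = unmatched x u₂ →
      x.length + 2 ≤ u₁.length → x.length + 2 ≤ u₂.length → Q x (u₁ ++ w) → Q x (u₂ ++ w) := by
    intro u₁ u₂ w h₁ h₂ h₃ h₄
    refine hQ _ _ _ _ rfl (hf.append h₁ w) (sameType_of_length_le ?_ ?_ ?_)
    · simp; omega
    · simp; omega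
    · rw [sublist_append_iff_unmatched, sublist_append_iff_unmatched, h₂]
  have hyi : p i ++ y.drop (x.length + 2 + i) = y := List.take_append_drop _ _
  have hyj : p j ++ y.drop (x.length + 2 + j) = y := List.take_append_drop _ _
  -- Repeat or delete the factor of `y` between the two prefixes.
  refine ⟨⟨p j ++ y.drop (x.length + 2 + i), ?_, ?_⟩,
    ⟨p i ++ y.drop (x.length + 2 + j), ?_, ?_, ?_⟩⟩
  · exact key _ hg.1 hun (by omega) (by omega) (by rwa [hyi])
  · simp only [length_append, hlj, length_drop]; omega
  · exact key _ hg.1.symm hun.symm (by omega) (by omega) (by rwa [hyj])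
  · simp only [length_append, hli, length_drop]; omega
  · simp only [length_append, hli, length_drop]; omega

theorem Recog.infinite {A : Type*} {N B : ℕ} {Q : List A → List A → Prop}
    (h : Recog N Q) {x y : List A} (hB : x.length + 2 + N * (x.length + 1) ≤ B) (hy : Q x y)
    (hl : B ≤ y.length) : {y | Q x y}.encard = ⊤ := by
  rw [Set.encard_eq_top_iff]
  intro hfin
  obtain ⟨z, hz, hmax⟩ := Set.exists_max_image _ List.length hfin ⟨y, hy⟩
  obtain ⟨⟨z', hz', hlt⟩, -⟩ := h.exists_pump hB hz (hl.trans (hmax y hy))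
  exact absurd (hmax z' hz') (by omega)

/-- An infinite set of the form `{y | Q x y}` has an element of length between `B` and `2 * B`:
longer elements can be pumped down by at most `B` letters at a time. -/
theorem Recog.exists_length_lt {A : Type*} {N B : ℕ} {Q : List A → List A → Prop}
    (h : Recog N Q) {x : List A} (hB : x.length + 2 + N * (x.length + 1) ≤ B) :
    ∀ {y}, Q x y → B ≤ y.length → ∃ y', Q x y' ∧ B ≤ y'.length ∧ y'.length < 2 * B := by
  intro y
  induction hn : y.length using Nat.strong_induction_on generalizing y with
  | _ n ih =>
    subst hn
    intro hy hl
    by_cases hlt : y.length < 2 * B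
    · exact ⟨y, hy, hl, hlt⟩
    · obtain ⟨-, y', hy', h₁, h₂⟩ := h.exists_pump hB hy hl
      exact ih _ h₁ rfl hy' (by omega)

/-! ### Bounds on the number of classes for formulas -/

theorem Recog.eq_const {A : Type*} (w : List A) : Recog (w.length + 2) fun _ y => y = w := by
  classical
  -- The class of a prefix of `w` is its length; all other words form one class.
  let f : List A → Option (Fin (w.length + 1)) := fun y =>
    if h : y <+: w then some ⟨y.length, Nat.lt_succ_of_le h.length_le⟩ else none
  have hf₁ : ∀ {u v}, f u = f v → u <+: w → u = v := by
    intro u v h hu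
    simp only [f, dif_pos hu] at h
    split_ifs at h with hv
    simp only [Option.some.injEq, Fin.mk.injEq] at h
    exact (List.prefix_of_prefix_length_le hu hv h.le).eq_of_length h
  refine .of_rightCongr (f := f) (by simp) (fun u v a h => ?_) ?_
  · by_cases hu : u <+: w
    · rw [hf₁ h hu]
    · by_cases hv : v <+: w
      · rw [hf₁ h.symm hv]
      · have g : ∀ {u : List A}, ¬ u <+: w → ¬ (u ++ [a]) <+: w := fun hu h =>
          hu ((prefix_append _ _).trans h)
        simp only [f, dif_neg (g hu), dif_neg (g hv)]
  · rintro x x' h rfl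
    exact (hf₁ h prefix_rfl).symm

/-- The subset construction: a class is the set of reachable states, as a vector of bits. -/
theorem Recog.language {A : Type*} (M : Automaton A) :
    Recog (2 ^ (M.initial.length + M.transitions.length)) fun _ y => y ∈ M.language := by
  classical
  -- All reachable states occur in the list `F`.
  let F : List ℕ := M.initial ++ M.transitions.map fun p => p.2.2
  have hF : ∀ (w : List A), ∀ t ∈ M.toNFA.evalFrom M.toNFA.start w, t ∈ F := by
    intro w
    induction w using List.reverseRecOn with
    | nil => exact fun t ht => mem_append_left _ ht
    | append_singleton w a ih =>
      intro t ht
      rw [NFA.evalFrom_append, NFA.evalFrom_singleton, NFA.mem_stepSet] at ht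
      obtain ⟨s, -, hs⟩ := ht
      exact mem_append_right _ (mem_map_of_mem (f := fun p => p.2.2) hs)
  let f : List A → (Fin F.length → Bool) := fun w i =>
    decide (F[i] ∈ M.toNFA.evalFrom M.toNFA.start w)
  have hf : ∀ {u v}, f u = f v → M.toNFA.evalFrom M.toNFA.start u =
      M.toNFA.evalFrom M.toNFA.start v := by
    have : ∀ {u v}, f u = f v → ∀ t ∈ M.toNFA.evalFrom M.toNFA.start u,
        t ∈ M.toNFA.evalFrom M.toNFA.start v := by
      intro u v h t ht
      obtain ⟨i, hi, rfl⟩ := List.mem_iff_getElem.1 (hF u t ht)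
      have := congrFun h ⟨i, hi⟩
      simpa [f, ht] using this
    exact fun {u v} h => Set.Subset.antisymm (this h) (this h.symm)
  refine .of_rightCongr (f := f) (by simp [F]) (fun u v a h => ?_) ?_
  · simp only [f, NFA.evalFrom_append, hf h]
  · intro x x' h hx
    change ∃ s ∈ M.toNFA.accept, s ∈ M.toNFA.evalFrom M.toNFA.start x at hx
    rw [hf h] at hx
    exact hx

theorem exists_recog_of_isRegular {A : Type*} {L : Language A} (hL : L.IsRegular) :
    ∃ K, Recog K fun _ y => y ∈ L := by
  obtain ⟨σ, hσ, D, rfl⟩ := hL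
  refine ⟨_, .of_rightCongr (f := D.eval) le_rfl (fun u v a h => ?_) ?_⟩
  · rw [DFA.eval_append_singleton, DFA.eval_append_singleton, h]
  · intro x x' h hx
    rw [DFA.mem_accepts] at hx ⊢
    rwa [← h]

/-- The bound in `Recog.count` when the threshold and the modulus are at most `n + 1`; the constant
`C` is the number of kinds. -/
def countBound (C n N : ℕ) : ℕ := N * (2 * n + 3) ^ (C * N)

theorem countBound_mono {C n n' N N' : ℕ} (hn : n ≤ n') (hN : N ≤ N') :
    countBound C n N ≤ countBound C n' N' := by
  refine Nat.mul_le_mul hN ((Nat.pow_le_pow_left (by omega) _).trans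
    (Nat.pow_le_pow_right (by omega) (Nat.mul_le_mul_left C hN)))

theorem le_countBound (C n N : ℕ) : N ≤ countBound C n N :=
  Nat.le_mul_of_pos_right N (by positivity)

/-- A bound for the number of classes that are needed for a formula with code less than `n`, where
`C` is the number of kinds and `K` the number of classes for the language `L`. -/
def stateBound (C K : ℕ) : ℕ → ℕ
  | 0 => 1
  | n + 1 => countBound C n ((n + 2) * 2 ^ (2 * n) * (K + 1) * (stateBound C K n * stateBound C K n))

theorem one_le_stateBound (C K n : ℕ) : 1 ≤ stateBound C K n := by
  induction n with
  | zero => exact le_rfl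
  | succ n ih =>
    refine le_trans ?_ (le_countBound _ _ _)
    have : 0 < stateBound C K n := ih
    exact Nat.succ_le_of_lt (by positivity)

theorem stateBound_succ_le (C K n : ℕ) : stateBound C K n ≤ stateBound C K (n + 1) := by
  refine le_trans ?_ (le_countBound _ _ _)
  have h : 0 < stateBound C K n := one_le_stateBound C K n
  calc stateBound C K n ≤ stateBound C K n * stateBound C K n := Nat.le_mul_of_pos_right _ h
    _ ≤ _ := Nat.le_mul_of_pos_left _ (by positivity)

theorem stateBound_mono (C K : ℕ) : Monotone (stateBound C K) :=
  monotone_nat_of_le_succ (stateBound_succ_le C K)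

theorem SameType.refl_refl {A : Type*} (x x' : List A) : SameType x x x' x' := by
  simp [SameType, covers_iff]

theorem SameType.symm {A : Type*} {x y x' y' : List A} (h : SameType x y x' y') :
    SameType y x y' x' :=
  ⟨h.2.1, h.1, h.2.2.2, h.2.2.1⟩

theorem Recog.const {A : Type*} (p : Prop) : Recog 1 fun _ _ : List A => p :=
  .of_sameType fun _ _ _ _ _ h => h

/-- Comparison with a constant `w` is expressed as `∃ y, y = w ∧ R x y`, so `Recog.count` applies. -/
theorem Recog.right_const {A : Type*} [Finite A] {R : List A → List A → Prop}
    (hR : ∀ x y x' y', SameType x y x' y' → R x y → R x' y') (w : List A) :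
    Recog (countBound (3 * Nat.card A + 9) w.length (w.length + 2)) fun x _ => R x w := by
  have h := ((Recog.eq_const w).and (.of_sameType hR)).count (t := 1) (q := 1) le_rfl le_rfl
    (S := fun m => m ≠ 0) ?_
  · have e : ∀ x, ({y | y = w ∧ R x y}.encard ≠ 0) = R x w := by
      intro x
      rw [Set.encard_ne_zero]
      refine propext ⟨?_, fun h => ⟨w, rfl, h⟩⟩
      rintro ⟨y, rfl, hy⟩
      exact hy
    simp only [e] at h
    rw [mul_one] at h
    refine h.mono ?_
    exact Nat.mul_le_mul_left _ (Nat.pow_le_pow_left (by omega) _)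
  · rintro m n (rfl | ⟨m, n, rfl, rfl, hm, hn, -⟩) h
    · exact h
    · simp; omega

theorem lt_pair_right {a b : ℕ} (ha : 1 ≤ a) : b < Nat.pair a b := by
  unfold Nat.pair
  split_ifs
  · nlinarith
  · nlinarith

/-- Atomic formulas `R s t` where `s` and `t` are arbitrary terms with codes at most `n`. -/
theorem Recog.atom {A : Type*} [Finite A] [Encodable A] {L : Language A}
    {R : List A → List A → Prop}
    (hR : ∀ x y x' y', SameType x y x' y' → R x y → R x' y') (s t : Term L) {n : ℕ}
    (hs : s.code ≤ n) (ht : t.code ≤ n) :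
    Recog (countBound (3 * Nat.card A + 9) n (n + 2))
      fun x y => R (s.val ![x, y]) (t.val ![x, y]) := by
  have h1 : 1 ≤ countBound (3 * Nat.card A + 9) n (n + 2) :=
    le_trans (by omega) (le_countBound _ _ _)
  have hw : ∀ w : {w // w ∈ L}, (Term.const w).code ≤ n →
      countBound (3 * Nat.card A + 9) w.1.length (w.1.length + 2) ≤
        countBound (3 * Nat.card A + 9) n (n + 2) := by
    intro w hw
    have : w.1.length ≤ n :=
      (Encodable.length_le_encode w.1).trans ((Nat.right_le_pair 1 _).trans hw)
    exact countBound_mono this (by omega)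
  have hR' : ∀ x y x' y', SameType x y x' y' → R y x → R y' x' :=
    fun x y x' y' h => hR _ _ _ _ h.symm
  rcases s with i | w <;> rcases t with j | w'
  · refine Recog.mono ?_ h1
    fin_cases i <;> fin_cases j
    · exact .of_sameType fun x y x' y' _ => hR _ _ _ _ (SameType.refl_refl x x')
    · exact .of_sameType hR
    · exact .of_sameType hR'
    · exact .of_sameType fun x y x' y' _ => hR _ _ _ _ (SameType.refl_refl y y')
  · have := (Recog.right_const hR w').mono (hw w' ht)
    fin_cases i
    · exact this
    · exact this.swap
  · have := (Recog.right_const hR' w).mono (hw w hs)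
    fin_cases j
    · exact this
    · exact this.swap
  · exact (Recog.const (R w.1 w'.1)).mono h1

theorem update_zero {A : Type*} (x y w : List A) : Function.update ![x, y] 0 w = ![w, y] := by
  ext i
  fin_cases i <;> simp

theorem update_one {A : Type*} (x y w : List A) : Function.update ![x, y] 1 w = ![x, w] := by
  ext i
  fin_cases i <;> simp

theorem Recog.quantifier {A : Type*} [Finite A] {L : Language A} {K N n t q : ℕ}
    (hL : Recog K fun _ y => y ∈ L) {φ : Formula L} (h : Recog N fun x y => φ.Sat ![x, y])
    (ht : 1 ≤ t) (hq : 1 ≤ q) (htn : t ≤ n + 1) (hqn : q ≤ n + 1)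
    {S : ℕ∞ → Prop} (hS : ∀ m n, CountEq t q m n → S m → S n) (i : Fin 2) :
    Recog (countBound (3 * Nat.card A + 9) n (K * N)) fun x y =>
      S {w : List A | w ∈ L ∧ φ.Sat (Function.update ![x, y] i w)}.encard := by
  have hb : ∀ N, N * (t + q + 1) ^ ((3 * Nat.card A + 9) * N) ≤
      countBound (3 * Nat.card A + 9) n N := fun N =>
    Nat.mul_le_mul_left _ (Nat.pow_le_pow_left (by omega) _)
  fin_cases i
  · have := ((hL.and h.swap).count ht hq hS).mono (hb _)
    refine Recog.swap (Q := fun y x => S {w : List A | w ∈ L ∧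
      φ.Sat (Function.update ![x, y] 0 w)}.encard) ?_
    simpa only [update_zero] using this
  · have := ((hL.and h).count ht hq hS).mono (hb _)
    change Recog _ fun x y => S {w : List A | w ∈ L ∧ φ.Sat (Function.update ![x, y] 1 w)}.encard
    simpa only [update_one] using this

theorem not_zero_of_countEq {m n : ℕ∞} (h : CountEq 1 1 m n) (hm : m ≠ 0) : n ≠ 0 := by
  rcases h with rfl | ⟨m, n, rfl, rfl, -, hn, -⟩
  · exact hm
  · simp; omega

theorem le_of_countEq {k : ℕ} {m n : ℕ∞} (h : CountEq (k + 1) 1 m n) (hm : k ≤ m) : k ≤ n := by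
  rcases h with rfl | ⟨m, n, rfl, rfl, -, hn, -⟩
  · exact hm
  · simp; omega

theorem exists_eq_add_mul_iff {q p m : ℕ} (hp : p < q) :
    (∃ n : ℕ, (m : ℕ∞) = ((p + q * n : ℕ) : ℕ∞)) ↔ m % q = p := by
  simp only [Nat.cast_inj]
  constructor
  · rintro ⟨n, rfl⟩
    simp [Nat.mod_eq_of_lt hp]
  · rintro rfl
    exact ⟨m / q, (Nat.mod_add_div m q).symm⟩

theorem modEq_of_countEq {q p : ℕ} (hp : p < q) {m n : ℕ∞} (h : CountEq 1 q m n)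
    (hm : ∃ k : ℕ, m = ((p + q * k : ℕ) : ℕ∞)) : ∃ k : ℕ, n = ((p + q * k : ℕ) : ℕ∞) := by
  rcases h with rfl | ⟨m, n, rfl, rfl, -, -, hmn⟩
  · exact hm
  · rw [exists_eq_add_mul_iff hp] at hm ⊢
    rw [← hm, hmn]

theorem sat_ex_iff {A : Type*} {L : Language A} {φ : Formula L} {v : Fin 2 → List A} {i : Fin 2} :
    (Formula.ex i φ).Sat v ↔
      {w : List A | w ∈ L ∧ φ.Sat (Function.update v i w)}.encard ≠ 0 := by
  rw [Set.encard_ne_zero]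
  rfl

/-- Every formula is recognized by a right congruence whose number of classes is bounded by a
function of the code of the formula. -/
theorem Formula.recog {A : Type*} [Finite A] [Encodable A] {L : Language A} {K : ℕ}
    (hL : Recog K fun _ y => y ∈ L) (φ : Formula L) :
    Recog (stateBound (3 * Nat.card A + 9) K (φ.code + 1)) fun x y => φ.Sat ![x, y] := by
  set C := 3 * Nat.card A + 9 with hC
  have key : ∀ {Q : List A → List A → Prop} {N c : ℕ}, Recog (countBound C c N) Q →
      N ≤ (c + 2) * 2 ^ (2 * c) * (K + 1) * (stateBound C K c * stateBound C K c) →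
      Recog (stateBound C K (c + 1)) Q :=
    fun h hN => h.mono (countBound_mono le_rfl hN)
  have hs : ∀ c, 0 < stateBound C K c * stateBound C K c := fun c =>
    Nat.mul_pos (one_le_stateBound C K c) (one_le_stateBound C K c)
  have key₁ : ∀ {Q : List A → List A → Prop} {c : ℕ}, Recog (countBound C c (c + 2)) Q →
      Recog (stateBound C K (c + 1)) Q := by
    intro Q c h
    refine key h ?_
    rw [mul_assoc, mul_assoc]
    exact Nat.le_mul_of_pos_right _ (Nat.mul_pos (by positivity)
      (Nat.mul_pos (Nat.succ_pos K) (hs c)))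
  have key₂ : ∀ {Q : List A → List A → Prop} {c N : ℕ}, N ≤ stateBound C K c →
      Recog (countBound C c (K * N)) Q → Recog (stateBound C K (c + 1)) Q := by
    intro Q c N hN h
    refine key h ?_
    rw [mul_assoc]
    refine le_trans (Nat.mul_le_mul (Nat.le_succ K) (hN.trans
      (Nat.le_mul_of_pos_right _ (one_le_stateBound C K c)))) ?_
    exact Nat.le_mul_of_pos_left _ (by positivity)
  have pl := Nat.left_le_pair
  have pr := Nat.right_le_pair
  induction φ with
  | eq s t =>
    refine key₁ (Recog.atom (R := fun u v => u = v) ?_ s t ?_ ?_)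
    · rintro x y x' y' h rfl
      exact (h.1.1 (Sublist.refl _)).antisymm (h.2.1.1 (Sublist.refl _))
    · exact (pl _ _).trans (pr _ _)
    · exact (pr _ _).trans (pr _ _)
  | subword s t =>
    refine key₁ (Recog.atom (R := fun u v => u.Sublist v) ?_ s t ?_ ?_)
    · exact fun x y x' y' h => h.1.1
    · exact (pl _ _).trans (pr _ _)
    · exact (pr _ _).trans (pr _ _)
  | covers s t =>
    refine key₁ (Recog.atom (R := Covers) ?_ s t ?_ ?_)
    · exact fun x y x' y' h => h.2.2.1.1
    · exact (pl _ _).trans (pr _ _)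
    · exact (pr _ _).trans (pr _ _)
  | mem M t =>
    rcases t with i | w
    · have hM : M.code ≤ (Formula.mem M (.var i) : Formula L).code := (pl _ _).trans (pr _ _)
      have h₁ : M.transitions.length ≤ M.code :=
        (Encodable.length_le_encode _).trans (pl _ _)
      have h₂ : M.initial.length ≤ M.code :=
        (Encodable.length_le_encode _).trans ((pl _ _).trans (pr _ _))
      have h := (Recog.language M).and hL
      have h' : Recog (stateBound C K ((Formula.mem M (.var i) : Formula L).code + 1))
          fun _ y => y ∈ M.language ∧ y ∈ L := by
        refine key (h.mono (le_countBound C _ _)) ?_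
        refine le_trans (Nat.mul_le_mul (Nat.pow_le_pow_right two_pos
          (show _ ≤ 2 * (Formula.mem M (.var i) : Formula L).code by omega)) (Nat.le_succ K)) ?_
        refine le_trans ?_ (Nat.le_mul_of_pos_right _ (hs _))
        exact Nat.mul_le_mul_right _ (Nat.le_mul_of_pos_left _ (Nat.succ_pos _))
      fin_cases i
      · exact h'.swap
      · exact h'
    · exact (Recog.const (w.1 ∈ M.language ∧ w.1 ∈ L)).mono (one_le_stateBound C K _)
  | not φ ih =>
    exact ih.not.mono (stateBound_mono C K (Nat.succ_le_succ (pr _ _)))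
  | and φ ψ ih₁ ih₂ =>
    have h₁ : φ.code + 1 ≤ (Formula.and φ ψ).code :=
      (Nat.succ_le_succ (pl _ _)).trans (lt_pair_right (by omega))
    have h₂ : ψ.code + 1 ≤ (Formula.and φ ψ).code :=
      (Nat.succ_le_succ (pr _ _)).trans (lt_pair_right (by omega))
    refine key (((ih₁.mono (stateBound_mono C K h₁)).and
      (ih₂.mono (stateBound_mono C K h₂))).mono (le_countBound C _ _)) ?_
    exact Nat.le_mul_of_pos_left _ (by positivity)
  | ex i φ ih =>
    have h₁ : φ.code + 1 ≤ (Formula.ex i φ).code :=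
      (Nat.succ_le_succ (pr _ _)).trans (lt_pair_right (by omega))
    simp only [sat_ex_iff]
    exact key₂ (stateBound_mono C K h₁) (hL.quantifier ih le_rfl le_rfl (by omega) (by omega)
      (fun m n => not_zero_of_countEq) i)
  | exGE k i φ ih =>
    have h₁ : φ.code + 1 ≤ (Formula.exGE k i φ).code :=
      (Nat.succ_le_succ ((pr _ _).trans (pr _ _))).trans (lt_pair_right (by omega))
    have h₂ : k ≤ (Formula.exGE k i φ).code := (pl _ _).trans (pr _ _)
    exact key₂ (stateBound_mono C K h₁) (hL.quantifier ih (by omega) le_rfl (by omega) (by omega)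
      (fun m n => le_of_countEq) i)
  | exMod q p i φ ih =>
    have h₁ : φ.code + 1 ≤ (Formula.exMod q p i φ).code :=
      (Nat.succ_le_succ ((pr _ _).trans ((pr _ _).trans (pr _ _)))).trans
        (lt_pair_right (by omega))
    have h₂ : q ≤ (Formula.exMod q p i φ).code := (pl _ _).trans (pr _ _)
    exact key₂ (stateBound_mono C K h₁) (hL.quantifier ih le_rfl (p.pos) (by omega) (by omega)
      (fun m n => modEq_of_countEq p.2) i)

/-! ### Primitive recursive building blocks -/

/-- The words of length less than `n` over the letters in `u`. -/
def words {A : Type*} (u : List A) : ℕ → List (List A)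
  | 0 => []
  | n + 1 => [] :: u.flatMap fun a => (words u n).map (List.cons a)

theorem mem_words {A : Type*} {u : List A} (hu : ∀ a, a ∈ u) {n : ℕ} {w : List A} :
    w ∈ words u n ↔ w.length < n := by
  induction n generalizing w with
  | zero => simp [words]
  | succ n ih =>
    rcases w with _ | ⟨a, w⟩
    · simp [words]
    · simp [words, ih, hu]

theorem nodup_words {A : Type*} {u : List A} (hu : u.Nodup) (n : ℕ) : (words u n).Nodup := by
  induction n with
  | zero => simp [words]
  | succ n ih =>
    refine nodup_cons.2 ⟨by simp, nodup_flatMap.2 ⟨fun a _ => ih.map fun _ _ h => ?_, ?_⟩⟩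
    · exact (List.cons.inj h).2
    · refine hu.imp fun {a b} hab => ?_
      intro w h₁ h₂
      simp only [mem_map] at h₁ h₂
      obtain ⟨w₁, -, rfl⟩ := h₁
      obtain ⟨w₂, -, h⟩ := h₂
      exact hab (List.cons.inj h).1.symm

theorem primrecRel_mem {A : Type*} [Primcodable A] :
    PrimrecRel fun (a : A) (l : List A) => a ∈ l :=
  ((Primrec.eq (α := A)).exists_mem_list.comp₂ Primrec₂.right Primrec₂.left).of_eq
    fun a l => by simp

theorem primrec_pow : Primrec₂ fun m n : ℕ => m ^ n :=
  Primrec₂.unpaired'.1 Nat.Primrec.pow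

theorem primrec_words {A : Type*} [Primcodable A] (u : List A) : Primrec (words u) := by
  have h : Primrec₂ fun (_ : ℕ) (l : List (List A)) =>
      [] :: u.flatMap fun a => l.map (List.cons a) := by
    refine Primrec.list_cons.comp (Primrec.const _) (Primrec.list_flatMap (Primrec.const u)
      (g := fun (p : ℕ × List (List A)) a => p.2.map (List.cons a)) ?_)
    exact Primrec.list_map (Primrec.snd.comp Primrec.fst)
      (Primrec.list_cons.comp (Primrec.snd.comp Primrec.fst) Primrec.snd)
  refine (Primrec.nat_rec₁ [] h).of_eq fun n => ?_
  induction n with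
  | zero => rfl
  | succ n ih => simp only [words, ← ih]

theorem primrec_unmatched {A : Type*} [Primcodable A] [DecidableEq A] :
    Primrec₂ fun x y : List A => unmatched x y := by
  refine Primrec.list_foldl Primrec.snd Primrec.fst (h := fun _ p => matchLetter p.1 p.2) ?_
  have h₁ : Primrec fun p : (List A × List A) × (List A × A) => p.2.1 :=
    Primrec.fst.comp Primrec.snd
  have h₂ : Primrec fun p : (List A × List A) × (List A × A) => p.2.2 :=
    Primrec.snd.comp Primrec.snd
  exact Primrec.ite (Primrec.eq.comp (Primrec.list_head?.comp h₁) (Primrec.option_some.comp h₂))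
    (Primrec.list_tail.comp h₁) h₁

theorem primrecRel_sublist {A : Type*} [Primcodable A] :
    PrimrecRel fun x y : List A => x.Sublist y := by
  classical
  exact (Primrec.eq.comp₂ primrec_unmatched (Primrec₂.const [])).of_eq
    fun x y => (sublist_iff_unmatched x y).symm

theorem primrecRel_covers {A : Type*} [Primcodable A] :
    PrimrecRel fun x y : List A => Covers x y := by
  have h : PrimrecRel fun x y : List A => y.length = x.length + 1 :=
    Primrec.eq.comp₂ (Primrec.list_length.comp Primrec.snd)
      (Primrec.succ.comp (Primrec.list_length.comp Primrec.fst))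
  exact (PrimrecPred.and primrecRel_sublist h).of_eq fun p => covers_iff.symm

/-- The components of an `Automaton`: transitions, initial states, accepting states. -/
abbrev AutomatonData (A : Type*) := List (ℕ × A × ℕ) × List ℕ × List ℕ

/-- The states that are reached from the states in `S` by reading the letter `a`. -/
def stepStates {A : Type*} [DecidableEq A] (tr : List (ℕ × A × ℕ)) (S : List ℕ) (a : A) : List ℕ :=
  (tr.filter fun p => p.1 ∈ S ∧ p.2.1 = a).map fun p => p.2.2

/-- The states that are reached from the initial states by reading the word `w`. -/
def reachStates {A : Type*} [DecidableEq A] (d : AutomatonData A) (w : List A) : List ℕ :=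
  w.foldl (stepStates d.1) d.2.1

theorem mem_language_iff {A : Type*} [DecidableEq A] (M : Automaton A) (w : List A) :
    w ∈ M.language ↔
      ∃ s ∈ M.accepting, s ∈ reachStates (M.transitions, M.initial, M.accepting) w := by
  have h : ∀ w t, t ∈ reachStates (M.transitions, M.initial, M.accepting) w ↔
      t ∈ M.toNFA.evalFrom M.toNFA.start w := by
    intro w
    induction w using List.reverseRecOn with
    | nil => exact fun t => Iff.rfl
    | append_singleton w a ih =>
      intro t
      rw [NFA.evalFrom_append, NFA.evalFrom_singleton, NFA.mem_stepSet, reachStates, foldl_append]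
      change t ∈ stepStates M.transitions
        (reachStates (M.transitions, M.initial, M.accepting) w) a ↔ _
      simp only [stepStates, mem_map, mem_filter, decide_eq_true_eq, ih, Prod.exists]
      constructor
      · rintro ⟨s, b, t', ⟨h, hs, rfl⟩, rfl⟩
        exact ⟨s, hs, h⟩
      · rintro ⟨s, hs, h⟩
        exact ⟨s, a, t, ⟨h, hs, rfl⟩, rfl⟩
  change (∃ s ∈ M.toNFA.accept, s ∈ M.toNFA.evalFrom M.toNFA.start w) ↔ _
  simp only [h]
  rfl

/-- The automaton with components `d` accepts `w`. -/
def Accepts {A : Type*} (d : AutomatonData A) (w : List A) : Prop :=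
  w ∈ (Automaton.mk d.1 d.2.1 d.2.2).language

theorem primrecRel_accepts {A : Type*} [Primcodable A] :
    PrimrecRel fun (d : AutomatonData A) w => Accepts d w := by
  classical
  have hstep : Primrec fun p : List (ℕ × A × ℕ) × List ℕ × A => stepStates p.1 p.2.1 p.2.2 := by
    have hR : PrimrecRel fun (t : ℕ × A × ℕ) (b : List ℕ × A) => t.1 ∈ b.1 ∧ t.2.1 = b.2 := by
      refine PrimrecPred.and ?_ ?_
      · exact primrecRel_mem.comp (Primrec.fst.comp Primrec.fst) (Primrec.fst.comp Primrec.snd)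
      · exact Primrec.eq.comp (Primrec.fst.comp (Primrec.snd.comp Primrec.fst))
          (Primrec.snd.comp Primrec.snd)
    refine (Primrec.list_map (hR.listFilter.comp Primrec.fst Primrec.snd)
      (g := fun _ t => t.2.2)
      (Primrec.snd.comp (Primrec.snd.comp Primrec.snd)).to₂).of_eq fun p => ?_
    simp [stepStates]
  have hreach : Primrec fun p : AutomatonData A × List A => reachStates p.1 p.2 := by
    refine Primrec.list_foldl Primrec.snd (Primrec.fst.comp (Primrec.snd.comp Primrec.fst))
      (h := fun (p : AutomatonData A × List A) (q : List ℕ × A) => stepStates p.1.1 q.1 q.2) ?_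
    exact hstep.comp (Primrec.pair (Primrec.fst.comp (Primrec.fst.comp Primrec.fst)) Primrec.snd)
  have h := primrecRel_mem (A := ℕ).exists_mem_list
  refine (h.comp (Primrec.snd.comp (Primrec.snd.comp Primrec.fst)) hreach).of_eq fun p => ?_
  exact (mem_language_iff (Automaton.mk p.1.1 p.1.2.1 p.1.2.2) p.2).symm

theorem primrecPred_mem_language {A : Type*} [Primcodable A] (M : Automaton A) :
    PrimrecPred fun w => w ∈ M.language :=
  primrecRel_accepts.comp (Primrec.const (M.transitions, M.initial, M.accepting)) Primrec.id

theorem primrec_stateBound (C K : ℕ) : Primrec (stateBound C K) := by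
  have h : Primrec₂ fun n s : ℕ => countBound C n
      ((n + 2) * 2 ^ (2 * n) * (K + 1) * (s * s)) := by
    have hn : Primrec fun p : ℕ × ℕ => p.1 := Primrec.fst
    have hs : Primrec fun p : ℕ × ℕ => p.2 := Primrec.snd
    have hN : Primrec fun p : ℕ × ℕ => (p.1 + 2) * 2 ^ (2 * p.1) * (K + 1) * (p.2 * p.2) :=
      Primrec.nat_mul.comp (Primrec.nat_mul.comp (Primrec.nat_mul.comp
        (Primrec.nat_add.comp hn (Primrec.const 2))
        (primrec_pow.comp (Primrec.const 2) (Primrec.nat_mul.comp (Primrec.const 2) hn)))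
        (Primrec.const (K + 1))) (Primrec.nat_mul.comp hs hs)
    exact Primrec.nat_mul.comp hN (primrec_pow.comp
      (Primrec.nat_add.comp (Primrec.nat_mul.comp (Primrec.const 2) hn) (Primrec.const 3))
      (Primrec.nat_mul.comp (Primrec.const C) hN))
  refine (Primrec.nat_rec₁ 1 h).of_eq fun n => ?_
  induction n with
  | zero => rfl
  | succ n ih => simp only [stateBound, ← ih]

/-! ### Codes of formulas and their free variables -/

/-- The number `k` is the code of a word in `L`. The first conjunct is needed since `decode` need
not be injective on the numbers on which it is defined. -/
def ConstCode {A : Type*} [Encodable A] (L : Language A) (k : ℕ) : Prop :=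
  k ∈ Set.range (Encodable.encode : List A → ℕ) ∧ (Encodable.decode (α := List A) k).getD [] ∈ L

theorem constCode_iff {A : Type*} [Encodable A] {L : Language A} {k : ℕ} :
    ConstCode L k ↔ ∃ w ∈ L, Encodable.encode w = k := by
  constructor
  · rintro ⟨⟨w, rfl⟩, h⟩
    exact ⟨w, by simpa using h, rfl⟩
  · rintro ⟨w, hw, rfl⟩
    exact ⟨⟨w, rfl⟩, by simpa using hw⟩

/-- A set of variables as a pair of bits. -/
def varBits (s : Finset (Fin 2)) : Bool × Bool := (decide (0 ∈ s), decide (1 ∈ s))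

/-- Union of sets of variables; `none` stands for an ill-formed code. -/
def unionBits (o o' : Option (Bool × Bool)) : Option (Bool × Bool) :=
  o.bind fun b => o'.map fun b' => (b.1 || b'.1, b.2 || b'.2)

/-- Removal of the variable with number `i`; `none` stands for an ill-formed code. -/
def eraseBits (i : ℕ) (o : Option (Bool × Bool)) : Option (Bool × Bool) :=
  if i = 0 then o.map fun b => (false, b.2) else if i = 1 then o.map fun b => (b.1, false) else none

open Classical in
/-- The variables of the term with code `m`, or `none` if there is no such term. -/
noncomputable def termVars {A : Type*} [Encodable A] (L : Language A) (m : ℕ) :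
    Option (Bool × Bool) :=
  if m = Nat.pair 0 0 then some (true, false)
  else if m = Nat.pair 0 1 then some (false, true)
  else if m.unpair.1 = 1 ∧ ConstCode L m.unpair.2 then some (false, false) else none

theorem termVars_eq_some_iff {A : Type*} [Encodable A] {L : Language A} {m : ℕ}
    {b : Bool × Bool} : termVars L m = some b ↔ ∃ t : Term L, t.code = m ∧ varBits t.vars = b := by
  constructor
  · intro h
    unfold termVars at h
    split_ifs at h with h₀ h₁ h₂
    · exact ⟨.var 0, h₀.symm, Option.some.inj h⟩
    · exact ⟨.var 1, h₁.symm, Option.some.inj h⟩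
    · obtain ⟨w, hw, e⟩ := constCode_iff.1 h₂.2
      refine ⟨.const ⟨w, hw⟩, ?_, Option.some.inj h⟩
      rw [Term.code, e, ← h₂.1, Nat.pair_unpair]
  · rintro ⟨t, rfl, rfl⟩
    rcases t with i | ⟨w, hw⟩
    · fin_cases i
      · simp [termVars, Term.code, Term.vars, varBits]
      · simp [termVars, Term.code, Term.vars, varBits, Nat.pair_eq_pair]
    · have h : ConstCode L (Encodable.encode w) := constCode_iff.2 ⟨w, hw, rfl⟩
      simp [termVars, Term.code, Term.vars, varBits, Nat.pair_eq_pair, h]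

open Classical in
/-- The free variables of the formula with code `n`, or `none` if there is no such formula. -/
noncomputable def freeVarsOfCode {A : Type*} [Encodable A] (L : Language A) (n : ℕ) :
    Option (Bool × Bool) :=
  if h : ∃ φ : Formula L, φ.code = n then some (varBits h.choose.freeVars) else none

theorem freeVarsOfCode_eq_some_iff {A : Type*} [Encodable A] {L : Language A} {n : ℕ}
    {b : Bool × Bool} :
    freeVarsOfCode L n = some b ↔ ∃ φ : Formula L, φ.code = n ∧ varBits φ.freeVars = b := by
  unfold freeVarsOfCode
  split_ifs with h
  · have e := h.choose_spec
    constructor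
    · intro hb
      exact ⟨_, e, Option.some.inj hb⟩
    · rintro ⟨φ, hφ, rfl⟩
      rw [Formula.code_injective (e.trans hφ.symm)]
  · simp only [false_iff]
    rintro ⟨φ, hφ, -⟩
    exact h ⟨φ, hφ⟩

/-- For the code `n` of a quantified formula, the code of the pair that consists of the quantified
variable and the formula in the scope of the quantifier. -/
def scopePair (n : ℕ) : ℕ :=
  if n.unpair.1 = 6 then n.unpair.2
  else if n.unpair.1 = 7 then n.unpair.2.unpair.2
  else n.unpair.2.unpair.2.unpair.2

/-- The codes of the immediate subformulas of the formula with code `n`. -/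
def subCodes (n : ℕ) : List ℕ :=
  if n.unpair.1 = 4 then [n.unpair.2]
  else if n.unpair.1 = 5 then [n.unpair.2.unpair.1, n.unpair.2.unpair.2]
  else if n.unpair.1 = 6 ∨ n.unpair.1 = 7 ∨ n.unpair.1 = 8 then [(scopePair n).unpair.2]
  else []

open Classical in
/-- The recursion for `freeVarsOfCode`; `hist` lists its values at `subCodes n`. -/
noncomputable def freeVarsStep {A : Type*} [Encodable A] (L : Language A) (n : ℕ)
    (hist : List (Option (Bool × Bool))) : Option (Bool × Bool) :=
  if n.unpair.1 < 3 then
    unionBits (termVars L n.unpair.2.unpair.1) (termVars L n.unpair.2.unpair.2)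
  else if n.unpair.1 = 3 then
    if n.unpair.2.unpair.1 ∈ Set.range (Encodable.encode : AutomatonData A → ℕ)
    then termVars L n.unpair.2.unpair.2 else none
  else if n.unpair.1 = 4 then hist.getD 0 none
  else if n.unpair.1 = 5 then unionBits (hist.getD 0 none) (hist.getD 1 none)
  else if n.unpair.1 = 6 ∨ n.unpair.1 = 7 ∨
      (n.unpair.1 = 8 ∧ n.unpair.2.unpair.2.unpair.1 < n.unpair.2.unpair.1) then
    eraseBits (scopePair n).unpair.1 (hist.getD 0 none)
  else none

theorem unionBits_eq_some_iff {o o' : Option (Bool × Bool)} {b : Bool × Bool} :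
    unionBits o o' = some b ↔
      ∃ c c', o = some c ∧ o' = some c' ∧ b = (c.1 || c'.1, c.2 || c'.2) := by
  rcases o with _ | c <;> rcases o' with _ | c' <;> simp [unionBits, eq_comm]

theorem varBits_union (s s' : Finset (Fin 2)) :
    varBits (s ∪ s') = ((varBits s).1 || (varBits s').1, (varBits s).2 || (varBits s').2) := by
  simp [varBits]

theorem eraseBits_eq_some_iff {i : ℕ} {o : Option (Bool × Bool)} {b : Bool × Bool} :
    eraseBits i o = some b ↔ ∃ c, o = some c ∧
      ((i = 0 ∧ b = (false, c.2)) ∨ (i = 1 ∧ b = (c.1, false))) := by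
  unfold eraseBits
  split_ifs with h₀ h₁
  · rcases o with _ | c <;> simp [h₀, eq_comm]
  · rcases o with _ | c <;> simp [h₁, eq_comm]
  · simp [h₀, h₁]

theorem varBits_erase_zero (s : Finset (Fin 2)) : varBits (s.erase 0) = (false, (varBits s).2) := by
  simp [varBits]

theorem varBits_erase_one (s : Finset (Fin 2)) : varBits (s.erase 1) = ((varBits s).1, false) := by
  simp [varBits]

theorem union_termVars_iff {A : Type*} [Encodable A] {L : Language A} {m m' : ℕ}
    {b : Bool × Bool} : unionBits (termVars L m) (termVars L m') = some b ↔
      ∃ s t : Term L, s.code = m ∧ t.code = m' ∧ varBits (s.vars ∪ t.vars) = b := by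
  simp only [unionBits_eq_some_iff, termVars_eq_some_iff, varBits_union]
  constructor
  · rintro ⟨_, _, ⟨s, hs, rfl⟩, ⟨t, ht, rfl⟩, rfl⟩
    exact ⟨s, t, hs, ht, rfl⟩
  · rintro ⟨s, t, hs, ht, rfl⟩
    exact ⟨_, _, ⟨s, hs, rfl⟩, ⟨t, ht, rfl⟩, rfl⟩

theorem erase_freeVarsOfCode_iff {A : Type*} [Encodable A] {L : Language A} {i m : ℕ}
    {b : Bool × Bool} : eraseBits i (freeVarsOfCode L m) = some b ↔
      ∃ (j : Fin 2) (φ : Formula L), (j : ℕ) = i ∧ φ.code = m ∧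
        varBits (φ.freeVars.erase j) = b := by
  simp only [eraseBits_eq_some_iff, freeVarsOfCode_eq_some_iff]
  constructor
  · rintro ⟨_, ⟨φ, hφ, rfl⟩, ⟨rfl, rfl⟩ | ⟨rfl, rfl⟩⟩
    · exact ⟨0, φ, rfl, hφ, varBits_erase_zero _⟩
    · exact ⟨1, φ, rfl, hφ, varBits_erase_one _⟩
  · rintro ⟨j, φ, rfl, hφ, rfl⟩
    refine ⟨_, ⟨φ, hφ, rfl⟩, ?_⟩
    fin_cases j
    · exact .inl ⟨rfl, varBits_erase_zero _⟩
    · exact .inr ⟨rfl, varBits_erase_one _⟩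

theorem freeVarsStep_eq {A : Type*} [Encodable A] (L : Language A) (n : ℕ) :
    freeVarsStep L n ((subCodes n).map (freeVarsOfCode L)) = freeVarsOfCode L n := by
  obtain ⟨k, m, rfl⟩ : ∃ k m, n = Nat.pair k m := ⟨_, _, (Nat.pair_unpair n).symm⟩
  ext b
  rw [freeVarsOfCode_eq_some_iff]
  obtain ⟨m₁, m₂, rfl⟩ : ∃ m₁ m₂, m = Nat.pair m₁ m₂ := ⟨_, _, (Nat.pair_unpair m).symm⟩
  have hk : ∀ φ : Formula L, φ.code = Nat.pair k (Nat.pair m₁ m₂) → k ≤ 8 := by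
    intro φ h
    cases φ <;> simp only [Formula.code, Nat.pair_eq_pair] at h <;> omega
  -- Numbers whose tag `k` exceeds `8` are no codes.
  rcases Nat.lt_or_ge 8 k with h8 | h8
  · have : ∀ j ≤ 8, k ≠ j := fun j hj => by omega
    simp only [freeVarsStep, Nat.unpair_pair]
    rw [if_neg (by omega), if_neg (by omega), if_neg (by omega), if_neg (by omega),
      if_neg (by omega)]
    simp only [reduceCtorEq, false_iff]
    rintro ⟨φ, h, -⟩
    have := hk φ h
    omega
  interval_cases k <;> simp only [freeVarsStep, subCodes, Nat.unpair_pair, scopePair] <;> norm_num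
  · rw [union_termVars_iff]
    constructor
    · rintro ⟨s, t, rfl, rfl, rfl⟩
      exact ⟨.eq s t, rfl, rfl⟩
    · rintro ⟨φ, h, rfl⟩
      cases φ <;> simp [Formula.code, Nat.pair_eq_pair] at h
      next s t => exact ⟨s, t, h.1, h.2, rfl⟩
  · rw [union_termVars_iff]
    constructor
    · rintro ⟨s, t, rfl, rfl, rfl⟩
      exact ⟨.subword s t, rfl, rfl⟩
    · rintro ⟨φ, h, rfl⟩
      cases φ <;> simp [Formula.code, Nat.pair_eq_pair] at h
      next s t => exact ⟨s, t, h.1, h.2, rfl⟩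
  · rw [union_termVars_iff]
    constructor
    · rintro ⟨s, t, rfl, rfl, rfl⟩
      exact ⟨.covers s t, rfl, rfl⟩
    · rintro ⟨φ, h, rfl⟩
      cases φ <;> simp [Formula.code, Nat.pair_eq_pair] at h
      next s t => exact ⟨s, t, h.1, h.2, rfl⟩
  · rw [termVars_eq_some_iff]
    constructor
    · rintro ⟨⟨a, a', c, rfl⟩, t, rfl, rfl⟩
      exact ⟨.mem ⟨a, a', c⟩ t, rfl, rfl⟩
    · rintro ⟨φ, h, rfl⟩
      cases φ <;> simp [Formula.code, Nat.pair_eq_pair] at h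
      next M t => exact ⟨⟨M.transitions, M.initial, M.accepting, h.1⟩, t, h.2, rfl⟩
  · rw [freeVarsOfCode_eq_some_iff]
    constructor
    · rintro ⟨φ, h, rfl⟩
      exact ⟨.not φ, by rw [Formula.code, h], rfl⟩
    · rintro ⟨φ, h, rfl⟩
      cases φ <;> simp [Formula.code, Nat.pair_eq_pair] at h
      next φ => exact ⟨φ, h, rfl⟩
  · simp only [unionBits_eq_some_iff, freeVarsOfCode_eq_some_iff]
    constructor
    · rintro ⟨_, _, ⟨φ, rfl, rfl⟩, ⟨ψ, rfl, rfl⟩, rfl⟩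
      exact ⟨.and φ ψ, rfl, varBits_union _ _⟩
    · rintro ⟨φ, h, rfl⟩
      cases φ <;> simp [Formula.code, Nat.pair_eq_pair] at h
      next φ ψ => exact ⟨_, _, ⟨φ, h.1, rfl⟩, ⟨ψ, h.2, rfl⟩, varBits_union _ _⟩
  · rw [erase_freeVarsOfCode_iff]
    constructor
    · rintro ⟨j, φ, rfl, rfl, rfl⟩
      exact ⟨.ex j φ, rfl, rfl⟩
    · rintro ⟨φ, h, rfl⟩
      cases φ <;> simp [Formula.code, Nat.pair_eq_pair] at h
      next j φ => exact ⟨j, φ, h.1, h.2, rfl⟩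
  · rw [erase_freeVarsOfCode_iff]
    constructor
    · rintro ⟨j, φ, hj, hφ, rfl⟩
      refine ⟨.exGE m₁ j φ, ?_, rfl⟩
      rw [Formula.code, hj, hφ, Nat.pair_unpair]
    · rintro ⟨φ, h, rfl⟩
      cases φ <;> simp [Formula.code, Nat.pair_eq_pair] at h
      next k j φ =>
        refine ⟨j, φ, ?_, ?_, rfl⟩ <;> rw [← h.2] <;> simp
  · rw [erase_freeVarsOfCode_iff]
    constructor
    · rintro ⟨hp, j, φ, hj, hφ, rfl⟩
      refine ⟨.exMod m₁ ⟨_, hp⟩ j φ, ?_, rfl⟩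
      rw [Formula.code, hj, hφ, Nat.pair_unpair, Nat.pair_unpair]
    · rintro ⟨φ, h, rfl⟩
      cases φ <;> simp [Formula.code, Nat.pair_eq_pair] at h
      next q p j φ =>
        obtain ⟨rfl, rfl⟩ := h
        simp only [Nat.unpair_pair]
        exact ⟨p.2, j, φ, rfl, rfl, rfl⟩

theorem primrec_scopePair : Primrec scopePair := by
  have h₁ : Primrec fun n : ℕ => n.unpair.1 := Primrec.fst.comp Primrec.unpair
  have h₂ : Primrec fun n : ℕ => n.unpair.2 := Primrec.snd.comp Primrec.unpair
  exact Primrec.ite (Primrec.eq.comp h₁ (Primrec.const 6)) h₂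
    (Primrec.ite (Primrec.eq.comp h₁ (Primrec.const 7)) (h₂.comp h₂) (h₂.comp (h₂.comp h₂)))

theorem primrec_subCodes : Primrec subCodes := by
  have h₁ : Primrec fun n : ℕ => n.unpair.1 := Primrec.fst.comp Primrec.unpair
  have h₂ : Primrec fun n : ℕ => n.unpair.2 := Primrec.snd.comp Primrec.unpair
  have eq : ∀ c, PrimrecPred fun n : ℕ => n.unpair.1 = c := fun c =>
    Primrec.eq.comp h₁ (Primrec.const c)
  have nil : Primrec fun _ : ℕ => ([] : List ℕ) := Primrec.const []
  exact Primrec.ite (eq 4) (Primrec.list_cons.comp h₂ nil)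
    (Primrec.ite (eq 5)
      (Primrec.list_cons.comp (h₁.comp h₂) (Primrec.list_cons.comp (h₂.comp h₂) nil))
      (Primrec.ite ((eq 6).or ((eq 7).or (eq 8)))
        (Primrec.list_cons.comp (h₂.comp primrec_scopePair) nil) nil))

theorem lt_of_mem_subCodes {n m : ℕ} (h : m ∈ subCodes n) : m < n := by
  have hl : ∀ k : ℕ, k.unpair.1 ≤ k := Nat.unpair_left_le
  have hr : ∀ k : ℕ, k.unpair.2 ≤ k := Nat.unpair_right_le
  have key : 1 ≤ n.unpair.1 → n.unpair.2 < n := fun h => by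
    conv_rhs => rw [← Nat.pair_unpair n]
    exact lt_pair_right h
  unfold subCodes scopePair at h
  split_ifs at h with h₁ h₂ h₃ h₄ h₅
  · rw [mem_singleton.1 h]
    exact key (by omega)
  · have := key (by omega)
    simp only [mem_cons, not_mem_nil, or_false] at h
    rcases h with rfl | rfl
    · exact (hl _).trans_lt this
    · exact (hr _).trans_lt this
  · rw [mem_singleton.1 h]
    exact (hr _).trans_lt (key (by omega))
  · rw [mem_singleton.1 h]
    exact ((hr _).trans (hr _)).trans_lt (key (by omega))
  · rw [mem_singleton.1 h]
    exact ((hr _).trans ((hr _).trans (hr _))).trans_lt (key (by omega))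
  · simp at h

theorem primrecPred_constCode {A : Type*} [Primcodable A] {L : Language A}
    (hL : PrimrecPred fun w => w ∈ L) : PrimrecPred (ConstCode L) :=
  Primcodable.mem_range_encode.and (hL.comp
    (Primrec.option_getD.comp Primrec.decode (Primrec.const [])))

theorem primrec_termVars {A : Type*} [Primcodable A] {L : Language A}
    (hL : PrimrecPred fun w => w ∈ L) : Primrec (termVars L) := by
  classical
  have eq : ∀ c, PrimrecPred fun n : ℕ => n = c := fun c =>
    Primrec.eq.comp Primrec.id (Primrec.const c)
  exact Primrec.ite (eq _) (Primrec.const _) (Primrec.ite (eq _) (Primrec.const _)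
    (Primrec.ite (PrimrecPred.and
      (Primrec.eq.comp (Primrec.fst.comp Primrec.unpair) (Primrec.const 1))
      ((primrecPred_constCode hL).comp (Primrec.snd.comp Primrec.unpair)))
      (Primrec.const _) (Primrec.const _)))

theorem primrec_freeVarsOfCode {A : Type*} [Primcodable A] {L : Language A}
    (hL : PrimrecPred fun w => w ∈ L) : Primrec (freeVarsOfCode L) := by
  classical
  refine Primrec.nat_omega_rec' (freeVarsOfCode L) (m := id) (l := subCodes)
    (g := fun n hist => some (freeVarsStep L n hist)) Primrec.id primrec_subCodes ?_
    (fun n m h => lt_of_mem_subCodes h) (fun n => congrArg some (freeVarsStep_eq L n))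
  have h₁ : Primrec fun n : ℕ => n.unpair.1 := Primrec.fst.comp Primrec.unpair
  have h₂ : Primrec fun n : ℕ => n.unpair.2 := Primrec.snd.comp Primrec.unpair
  have fs : Primrec fun p : ℕ × List (Option (Bool × Bool)) => p.1 := Primrec.fst
  have eq : ∀ c, PrimrecPred fun p : ℕ × List (Option (Bool × Bool)) => p.1.unpair.1 = c :=
    fun c => Primrec.eq.comp (h₁.comp fs) (Primrec.const c)
  have hist : ∀ i, Primrec fun p : ℕ × List (Option (Bool × Bool)) => p.2.getD i none :=
    fun i => (Primrec.list_getD none).comp Primrec.snd (Primrec.const i)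
  have union : Primrec₂ unionBits :=
    Primrec.dom_finite fun p : Option (Bool × Bool) × Option (Bool × Bool) => unionBits p.1 p.2
  have erase : Primrec₂ eraseBits :=
    Primrec.ite (Primrec.eq.comp Primrec.fst (Primrec.const 0))
      ((Primrec.dom_finite (Option.map fun b : Bool × Bool => (false, b.2))).comp Primrec.snd)
      (Primrec.ite (Primrec.eq.comp Primrec.fst (Primrec.const 1))
        ((Primrec.dom_finite (Option.map fun b : Bool × Bool => (b.1, false))).comp Primrec.snd)
        (Primrec.const none))
  have tv := primrec_termVars hL
  refine Primrec.option_some.comp ?_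
  exact Primrec.ite (Primrec.nat_lt.comp (h₁.comp fs) (Primrec.const 3))
    (union.comp (tv.comp (h₁.comp (h₂.comp fs))) (tv.comp (h₂.comp (h₂.comp fs))))
    (Primrec.ite (eq 3)
      (Primrec.ite (Primcodable.mem_range_encode.comp (h₁.comp (h₂.comp fs)))
        (tv.comp (h₂.comp (h₂.comp fs))) (Primrec.const none))
      (Primrec.ite (eq 4) (hist 0)
        (Primrec.ite (eq 5) (union.comp (hist 0) (hist 1))
          (Primrec.ite ((eq 6).or ((eq 7).or ((eq 8).and
            (Primrec.nat_lt.comp (h₁.comp (h₂.comp (h₂.comp fs))) (h₁.comp (h₂.comp fs))))))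
            (erase.comp (h₁.comp (primrec_scopePair.comp fs)) (hist 0))
            (Primrec.const none)))))

/-! ### Evaluation of formulas with bounded quantifiers -/

/-- The value of the term with code `m` under the assignment `![x, y]`. -/
def termVal {A : Type*} [Encodable A] (x y : List A) (m : ℕ) : List A :=
  if m = Nat.pair 0 0 then x
  else if m = Nat.pair 0 1 then y
  else (Encodable.decode (α := List A) m.unpair.2).getD []

theorem termVal_code {A : Type*} [Encodable A] {L : Language A} (x y : List A) (t : Term L) :
    termVal x y t.code = t.val ![x, y] := by
  rcases t with i | ⟨w, hw⟩
  · fin_cases i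
    · simp [termVal, Term.code, Term.val]
    · simp [termVal, Term.code, Term.val, Nat.pair_eq_pair]
  · simp [termVal, Term.code, Term.val, Nat.pair_eq_pair]

/-- The pair `(x, y)` with the component that belongs to the variable `i` replaced by `w`. -/
def updatePair {A : Type*} (i : ℕ) (x y w : List A) : List A × List A :=
  if i = 0 then (w, y) else (x, w)

theorem update_eq_updatePair {A : Type*} (i : Fin 2) (x y w : List A) :
    Function.update ![x, y] i w = ![(updatePair i x y w).1, (updatePair i x y w).2] := by
  fin_cases i
  · exact update_zero x y w
  · exact update_one x y w

/-- A bound for the lengths in the evaluation of the quantified formula with code `n`: the set that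
is counted is infinite if and only if it has an element of length at least this bound. -/
def lengthBound (C K n : ℕ) (x y : List A) : ℕ :=
  x.length + y.length + 2 + K * stateBound C K n * (x.length + y.length + 1)

open Classical in
/-- The words in `L` of length less than `n`. -/
noncomputable def shortWords {A : Type*} (L : Language A) (u : List A) (n : ℕ) : List (List A) :=
  (words u n).filter fun w => w ∈ L

open Classical in
/-- The words in `L` of length at least `n` and less than `2 * n`; if a definable set
has elements of length at least the bound `n`, then it has some among these. -/
noncomputable def middleWords {A : Type*} (L : Language A) (u : List A) (n : ℕ) : List (List A) :=
  (words u (2 * n)).filter fun w => n ≤ w.length ∧ w ∈ L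

/-- The number of witnesses for a quantifier can be determined by testing the words of length less
than `2 * n`. -/
theorem encard_eq_length_filter {A : Type*} [Finite A] {L : Language A} {u : List A}
    (hu : ∀ a, a ∈ u) (hu' : u.Nodup) {K N n : ℕ} (hL : Recog K fun _ y => y ∈ L) {φ : Formula L}
    (h : Recog N fun x y => φ.Sat ![x, y]) (i : Fin 2) (x y : List A)
    (hn : x.length + y.length + 2 + K * N * (x.length + y.length + 1) ≤ n) (p : List A → Bool)
    (hp : ∀ w, p w = true ↔ φ.Sat (Function.update ![x, y] i w)) :
    {w | w ∈ L ∧ φ.Sat (Function.update ![x, y] i w)}.encard =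
      if ∃ w ∈ middleWords L u n, p w = true then ⊤
      else (((shortWords L u n).filter p).length : ℕ∞) := by
  have key : ∃ (Q : List A → List A → Prop) (z : List A), Recog (K * N) Q ∧
      z.length ≤ x.length + y.length ∧
      ∀ w, Q z w ↔ (w ∈ L ∧ φ.Sat (Function.update ![x, y] i w)) := by
    fin_cases i
    · refine ⟨_, y, hL.and h.swap, by omega, fun w => ?_⟩
      change _ ↔ (w ∈ L ∧ φ.Sat (Function.update ![x, y] 0 w))
      rw [update_zero]
    · refine ⟨_, x, hL.and h, by omega, fun w => ?_⟩
      change _ ↔ (w ∈ L ∧ φ.Sat (Function.update ![x, y] 1 w))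
      rw [update_one]
  obtain ⟨Q, z, hQ, hz, hQz⟩ := key
  have hB : z.length + 2 + K * N * (z.length + 1) ≤ n := by
    have : K * N * (z.length + 1) ≤ K * N * (x.length + y.length + 1) :=
      Nat.mul_le_mul_left _ (by omega)
    omega
  simp only [← hQz] at hp ⊢
  have hmid : ∀ w, (w ∈ middleWords L u n ∧ p w = true) ↔
      (Q z w ∧ n ≤ w.length ∧ w.length < 2 * n) := by
    intro w
    simp only [middleWords, mem_filter, mem_words hu, decide_eq_true_eq, hp, hQz]
    tauto
  split_ifs with hex
  · obtain ⟨w, hw⟩ := hex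
    have := (hmid w).1 hw
    exact hQ.infinite hB this.1 this.2.1
  · have hlt : ∀ w, Q z w → w.length < n := by
      intro w hw
      by_contra hc
      obtain ⟨w', h₁, h₂, h₃⟩ := hQ.exists_length_lt hB hw (not_lt.1 hc)
      exact hex ⟨w', (hmid w').2 ⟨h₁, h₂, h₃⟩⟩
    have hnd : ((shortWords L u n).filter p).Nodup := ((nodup_words hu' n).filter _).filter _
    classical
    rw [← List.toFinset_card_of_nodup hnd, ← Set.encard_coe_eq_coe_finsetCard]
    congr 1
    ext w
    simp only [shortWords, coe_toFinset, Set.mem_ofPred_eq, mem_filter, mem_words hu,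
      decide_eq_true_eq, hp]
    exact ⟨fun hw => ⟨⟨hlt w hw, ((hQz w).1 hw).1⟩, ((hQz w).1 hw).2⟩,
      fun hw => (hQz w).2 ⟨hw.1.2, hw.2⟩⟩

/-- The codes and assignments at which the truth value has to be known in order to determine it at
`b`. For a quantified formula, the short words come before the middle ones. -/
noncomputable def subInputs {A : Type*} (L : Language A) (u : List A) (C K : ℕ)
    (b : ℕ × List A × List A) : List (ℕ × List A × List A) :=
  if b.1.unpair.1 < 6 then (subCodes b.1).map fun c => (c, b.2)
  else if b.1.unpair.1 < 9 then
    (shortWords L u (lengthBound C K b.1 b.2.1 b.2.2) ++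
      middleWords L u (lengthBound C K b.1 b.2.1 b.2.2)).map fun w =>
        ((scopePair b.1).unpair.2, updatePair (scopePair b.1).unpair.1 b.2.1 b.2.2 w)
  else []

/-- `b.1` is the code of a formula that holds under the assignment `![b.2.1, b.2.2]`. -/
def SatCode {A : Type*} [Encodable A] (L : Language A) (b : ℕ × List A × List A) : Prop :=
  ∃ φ : Formula L, φ.code = b.1 ∧ φ.Sat ![b.2.1, b.2.2]

theorem satCode_iff {A : Type*} [Encodable A] {L : Language A} (φ : Formula L) (x y : List A) :
    SatCode L (φ.code, x, y) ↔ φ.Sat ![x, y] := by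
  constructor
  · rintro ⟨ψ, h, hs⟩
    rwa [← Formula.code_injective h]
  · exact fun h => ⟨φ, rfl, h⟩

/-- The recursion for `SatCode`; `hist` lists its truth values at `subInputs L u C K b`.
Well-formedness is tested separately, since for empty `L` the list `hist` may be empty. -/
def EvalStep {A : Type*} [Encodable A] (L : Language A) (u : List A) (C K : ℕ)
    (b : ℕ × List A × List A) (hist : List Bool) : Prop :=
  let tag := b.1.unpair.1
  let body := b.1.unpair.2
  let s := termVal b.2.1 b.2.2 body.unpair.1
  let t := termVal b.2.1 b.2.2 body.unpair.2
  let k := (shortWords L u (lengthBound C K b.1 b.2.1 b.2.2)).length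
  freeVarsOfCode L b.1 ≠ none ∧
    ((tag = 0 ∧ s = t) ∨ (tag = 1 ∧ s.Sublist t) ∨ (tag = 2 ∧ Covers s t) ∨
    (tag = 3 ∧
      Accepts ((Encodable.decode (α := AutomatonData A) body.unpair.1).getD ([], [], [])) t ∧
      t ∈ L) ∨
    (tag = 4 ∧ hist.getD 0 false = false) ∨
    (tag = 5 ∧ hist.getD 0 false = true ∧ hist.getD 1 false = true) ∨
    (tag = 6 ∧ true ∈ hist) ∨
    (tag = 7 ∧ (true ∈ hist.drop k ∨ body.unpair.1 ≤ ((hist.take k).filter (· = true)).length)) ∨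
    (tag = 8 ∧ true ∉ hist.drop k ∧
      ((hist.take k).filter (· = true)).length % body.unpair.1 = body.unpair.2.unpair.1))

open Classical in
/-- The truth values at the inputs in `l`. -/
noncomputable def satHistory {A : Type*} [Encodable A] (L : Language A)
    (l : List (ℕ × List A × List A)) : List Bool :=
  l.map fun b => decide (SatCode L b)

theorem encard_eq_history {A : Type*} [Finite A] [Encodable A] {L : Language A} {u : List A}
    (hu : ∀ a, a ∈ u) (hu' : u.Nodup) {K : ℕ} (hL : Recog K fun _ y => y ∈ L) {φ : Formula L}
    {c : ℕ} (hc : φ.code + 1 ≤ c) (i : Fin 2) (x y : List A) {hist : List Bool} {n k : ℕ}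
    (hn : n = lengthBound (3 * Nat.card A + 9) K c x y) (hk : k = (shortWords L u n).length)
    (hh : hist = satHistory L ((shortWords L u n ++ middleWords L u n).map fun w =>
      (φ.code, updatePair i x y w))) :
    {w | w ∈ L ∧ φ.Sat (Function.update ![x, y] i w)}.encard =
      if true ∈ hist.drop k then ⊤ else (((hist.take k).filter (· = true)).length : ℕ∞) := by
  classical
  set p : List A → Bool := fun w => decide (SatCode L (φ.code, updatePair i x y w)) with hp
  have hp' : ∀ w, p w = true ↔ φ.Sat (Function.update ![x, y] i w) := by
    intro w
    rw [hp, decide_eq_true_iff, update_eq_updatePair]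
    exact satCode_iff φ _ _
  have hhist : hist = (shortWords L u n).map p ++ (middleWords L u n).map p := by
    rw [hh, satHistory, map_map, map_append]
    rfl
  rw [encard_eq_length_filter hu hu' hL ((φ.recog hL).mono (stateBound_mono _ _ hc)) i x y
    hn.ge p hp', hhist, hk, take_left' (length_map _), drop_left' (length_map _)]
  have h₁ : (true ∈ (middleWords L u n).map p) ↔ ∃ w ∈ middleWords L u n, p w = true := mem_map
  have h₂ : ((shortWords L u n).map p).filter (· = true) = ((shortWords L u n).filter p).map p := by
    rw [filter_map]
    congr 2
    funext w
    simp
  simp only [h₁, h₂, length_map]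

theorem subInputs_eq {A : Type*} {L : Language A} {u : List A} {C K c i m : ℕ} {x y : List A}
    (h : c.unpair.1 = 6 ∨ c.unpair.1 = 7 ∨ c.unpair.1 = 8) (hc : scopePair c = Nat.pair i m) :
    subInputs L u C K (c, x, y) = (shortWords L u (lengthBound C K c x y) ++
      middleWords L u (lengthBound C K c x y)).map fun w => (m, updatePair i x y w) := by
  simp only [subInputs, hc, Nat.unpair_pair]
  rw [if_neg (by omega), if_pos (by omega)]

theorem evalStep_iff {A : Type*} [Finite A] [Encodable A] {L : Language A} {u : List A}
    (hu : ∀ a, a ∈ u) (hu' : u.Nodup) {K : ℕ} (hL : Recog K fun _ y => y ∈ L)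
    (b : ℕ × List A × List A) :
    EvalStep L u (3 * Nat.card A + 9) K b
      (satHistory L (subInputs L u (3 * Nat.card A + 9) K b)) ↔ SatCode L b := by
  obtain ⟨c, x, y⟩ := b
  by_cases hc : freeVarsOfCode L c = none
  -- Ill-formed codes.
  · refine iff_of_false (fun h => h.1 hc) ?_
    rintro ⟨φ, hφ, -⟩
    have := freeVarsOfCode_eq_some_iff.2 ⟨φ, hφ, rfl⟩
    simp only at this
    rw [hc] at this
    cases this
  obtain ⟨φ, rfl⟩ : ∃ φ : Formula L, φ.code = c := by
    obtain ⟨b, hb⟩ := Option.ne_none_iff_exists'.1 hc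
    obtain ⟨φ, hφ, -⟩ := freeVarsOfCode_eq_some_iff.1 hb
    exact ⟨φ, hφ⟩
  rw [satCode_iff]
  cases φ with
  | eq s t => simp [EvalStep, hc]; simp [Formula.code, termVal_code, Formula.Sat]
  | subword s t => simp [EvalStep, hc]; simp [Formula.code, termVal_code, Formula.Sat]
  | covers s t => simp [EvalStep, hc]; simp [Formula.code, termVal_code, Formula.Sat]
  | mem M t =>
    simp [EvalStep, hc]; simp [Formula.code, termVal_code, Formula.Sat, Automaton.code, Accepts]
  | not φ =>
    simp [EvalStep, hc]
    simp [Formula.code, subInputs, subCodes, satHistory, satCode_iff, Formula.Sat]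
  | and φ ψ =>
    simp [EvalStep, hc]
    simp [Formula.code, subInputs, subCodes, satHistory, satCode_iff, Formula.Sat]
  | ex i φ =>
    have hlt : φ.code + 1 ≤ (Formula.ex i φ).code :=
      (Nat.succ_le_succ (Nat.right_le_pair _ _)).trans (lt_pair_right (by omega))
    have h := encard_eq_history hu hu' hL hlt i x y rfl rfl
      (congrArg (satHistory L) (subInputs_eq (by simp [Formula.code]) (by
        simp [scopePair, Formula.code])))
    rw [sat_ex_iff, h]
    set hist := satHistory L (subInputs L u (3 * Nat.card A + 9) K ((Formula.ex i φ).code, x, y))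
    set k := (shortWords L u
      (lengthBound (3 * Nat.card A + 9) K (Formula.ex i φ).code x y)).length with hk
    have hs : EvalStep L u (3 * Nat.card A + 9) K ((Formula.ex i φ).code, x, y) hist ↔
        true ∈ hist := by
      simp [EvalStep, hc]
      simp [Formula.code]
    rw [hs]
    nth_rewrite 1 [← take_append_drop k hist]
    rw [mem_append]
    split_ifs with ht
    · simp [ht]
    · simp only [ht, or_false, ne_eq, Nat.cast_eq_zero, length_eq_zero_iff]
      rw [filter_eq_nil_iff]
      simp
  | exGE m i φ =>
    have hlt : φ.code + 1 ≤ (Formula.exGE m i φ).code :=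
      (Nat.succ_le_succ ((Nat.right_le_pair _ _).trans (Nat.right_le_pair _ _))).trans
        (lt_pair_right (by omega))
    have h := encard_eq_history hu hu' hL hlt i x y rfl rfl
      (congrArg (satHistory L) (subInputs_eq (by simp [Formula.code]) (by
        simp [scopePair, Formula.code])))
    rw [Formula.Sat, h]
    set hist := satHistory L
      (subInputs L u (3 * Nat.card A + 9) K ((Formula.exGE m i φ).code, x, y))
    set k := (shortWords L u
      (lengthBound (3 * Nat.card A + 9) K (Formula.exGE m i φ).code x y)).length with hk
    have hs : EvalStep L u (3 * Nat.card A + 9) K ((Formula.exGE m i φ).code, x, y) hist ↔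
        true ∈ hist.drop k ∨ m ≤ ((hist.take k).filter (· = true)).length := by
      simp [EvalStep, hc, ← hk]
      simp [Formula.code]
    rw [hs]
    split_ifs with ht
    · simp [ht]
    · simp only [ht, false_or, Nat.cast_le]
  | exMod q p i φ =>
    have hlt : φ.code + 1 ≤ (Formula.exMod q p i φ).code :=
      (Nat.succ_le_succ ((Nat.right_le_pair _ _).trans ((Nat.right_le_pair _ _).trans
        (Nat.right_le_pair _ _)))).trans (lt_pair_right (by omega))
    have h := encard_eq_history hu hu' hL hlt i x y rfl rfl
      (congrArg (satHistory L) (subInputs_eq (by simp [Formula.code]) (by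
        simp [scopePair, Formula.code])))
    rw [Formula.Sat, h]
    set hist := satHistory L
      (subInputs L u (3 * Nat.card A + 9) K ((Formula.exMod q p i φ).code, x, y))
    set k := (shortWords L u
      (lengthBound (3 * Nat.card A + 9) K (Formula.exMod q p i φ).code x y)).length with hk
    have hs : EvalStep L u (3 * Nat.card A + 9) K ((Formula.exMod q p i φ).code, x, y) hist ↔
        true ∉ hist.drop k ∧ ((hist.take k).filter (· = true)).length % q = p := by
      simp [EvalStep, hc, ← hk]
      simp [Formula.code]
    rw [hs]
    split_ifs with ht
    · simp only [ht, not_true_eq_false, false_and, false_iff, not_exists]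
      exact fun n hn => ENat.natCast_ne_top _ hn.symm
    · simp only [ht, not_false_eq_true, true_and]
      exact (exists_eq_add_mul_iff p.2).symm

/-! ### Primitive recursiveness of the evaluator -/

theorem primrec_termVal {A : Type*} [Primcodable A] :
    Primrec fun p : (List A × List A) × ℕ => termVal p.1.1 p.1.2 p.2 := by
  have eq : ∀ c, PrimrecPred fun p : (List A × List A) × ℕ => p.2 = c := fun c =>
    Primrec.eq.comp Primrec.snd (Primrec.const c)
  exact Primrec.ite (eq _) (Primrec.fst.comp Primrec.fst) (Primrec.ite (eq _)
    (Primrec.snd.comp Primrec.fst) (Primrec.option_getD.comp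
      (Primrec.decode.comp (Primrec.snd.comp (Primrec.unpair.comp Primrec.snd)))
      (Primrec.const [])))

theorem primrec_updatePair {A : Type*} [Primcodable A] :
    Primrec fun p : ℕ × (List A × List A) × List A => updatePair p.1 p.2.1.1 p.2.1.2 p.2.2 := by
  have hw : Primrec fun p : ℕ × (List A × List A) × List A => p.2.2 :=
    Primrec.snd.comp Primrec.snd
  have hp : Primrec fun p : ℕ × (List A × List A) × List A => p.2.1 :=
    Primrec.fst.comp Primrec.snd
  exact Primrec.ite (Primrec.eq.comp Primrec.fst (Primrec.const 0))
    (Primrec.pair hw (Primrec.snd.comp hp)) (Primrec.pair (Primrec.fst.comp hp) hw)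

theorem primrec_lengthBound {A : Type*} [Primcodable A] (C K : ℕ) :
    Primrec fun b : ℕ × List A × List A => lengthBound C K b.1 b.2.1 b.2.2 := by
  have hl : Primrec fun b : ℕ × List A × List A => b.2.1.length + b.2.2.length :=
    Primrec.nat_add.comp (Primrec.list_length.comp (Primrec.fst.comp Primrec.snd))
      (Primrec.list_length.comp (Primrec.snd.comp Primrec.snd))
  exact Primrec.nat_add.comp (Primrec.nat_add.comp hl (Primrec.const 2))
    (Primrec.nat_mul.comp (Primrec.nat_mul.comp (Primrec.const K)
      ((primrec_stateBound C K).comp Primrec.fst)) (Primrec.succ.comp hl))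

theorem primrec_shortWords {A : Type*} [Primcodable A] {L : Language A}
    (hL : PrimrecPred fun w => w ∈ L) (u : List A) : Primrec (shortWords L u) := by
  classical
  exact (Primrec.listFilter hL).comp (primrec_words u)

theorem primrec_middleWords {A : Type*} [Primcodable A] {L : Language A}
    (hL : PrimrecPred fun w => w ∈ L) (u : List A) : Primrec (middleWords L u) := by
  classical
  have hR : PrimrecRel fun (w : List A) (n : ℕ) => n ≤ w.length ∧ w ∈ L :=
    PrimrecPred.and (Primrec.nat_le.comp Primrec.snd (Primrec.list_length.comp Primrec.fst))
      (hL.comp Primrec.fst)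
  exact hR.listFilter.comp ((primrec_words u).comp (Primrec.nat_mul.comp (Primrec.const 2)
    Primrec.id)) Primrec.id

theorem primrec_subInputs {A : Type*} [Primcodable A] {L : Language A}
    (hL : PrimrecPred fun w => w ∈ L) (u : List A) (C K : ℕ) :
    Primrec (subInputs L u C K) := by
  have h₁ : Primrec fun n : ℕ => n.unpair.1 := Primrec.fst.comp Primrec.unpair
  have h₂ : Primrec fun n : ℕ => n.unpair.2 := Primrec.snd.comp Primrec.unpair
  have lt : ∀ c, PrimrecPred fun b : ℕ × List A × List A => b.1.unpair.1 < c := fun c =>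
    Primrec.nat_lt.comp (h₁.comp Primrec.fst) (Primrec.const c)
  have hB := primrec_lengthBound (A := A) C K
  refine Primrec.ite (lt 6) ?_ (Primrec.ite (lt 9) ?_ (Primrec.const []))
  · exact Primrec.list_map (primrec_subCodes.comp Primrec.fst)
      (Primrec.pair Primrec.snd (Primrec.snd.comp Primrec.fst)).to₂
  · have hs : Primrec fun p : (ℕ × List A × List A) × List A => scopePair p.1.1 :=
      primrec_scopePair.comp (Primrec.fst.comp Primrec.fst)
    have hg : Primrec₂ fun (b : ℕ × List A × List A) (w : List A) =>
        ((scopePair b.1).unpair.2, updatePair (scopePair b.1).unpair.1 b.2.1 b.2.2 w) :=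
      Primrec.pair (h₂.comp hs) (primrec_updatePair.comp (Primrec.pair (h₁.comp hs)
        (Primrec.pair (Primrec.snd.comp Primrec.fst) Primrec.snd)))
    exact Primrec.list_map (Primrec.list_append.comp ((primrec_shortWords hL u).comp hB)
      ((primrec_middleWords hL u).comp hB)) hg

theorem primrecRel_evalStep {A : Type*} [Primcodable A] {L : Language A}
    (hL : PrimrecPred fun w => w ∈ L) (u : List A) (C K : ℕ) :
    PrimrecRel (EvalStep L u C K) := by
  have h₁ : Primrec fun n : ℕ => n.unpair.1 := Primrec.fst.comp Primrec.unpair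
  have h₂ : Primrec fun n : ℕ => n.unpair.2 := Primrec.snd.comp Primrec.unpair
  have hc : Primrec fun p : (ℕ × List A × List A) × List Bool => p.1.1 :=
    Primrec.fst.comp Primrec.fst
  have hist : Primrec fun p : (ℕ × List A × List A) × List Bool => p.2 := Primrec.snd
  have tag : ∀ c, PrimrecPred fun p : (ℕ × List A × List A) × List Bool => p.1.1.unpair.1 = c :=
    fun c => Primrec.eq.comp (h₁.comp hc) (Primrec.const c)
  have hb₁ : Primrec fun p : (ℕ × List A × List A) × List Bool => p.1.1.unpair.2.unpair.1 :=
    h₁.comp (h₂.comp hc)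
  have hb₂ : Primrec fun p : (ℕ × List A × List A) × List Bool => p.1.1.unpair.2.unpair.2 :=
    h₂.comp (h₂.comp hc)
  have hs : Primrec fun p : (ℕ × List A × List A) × List Bool =>
      termVal p.1.2.1 p.1.2.2 p.1.1.unpair.2.unpair.1 :=
    primrec_termVal.comp (Primrec.pair (Primrec.snd.comp Primrec.fst) hb₁)
  have ht : Primrec fun p : (ℕ × List A × List A) × List Bool =>
      termVal p.1.2.1 p.1.2.2 p.1.1.unpair.2.unpair.2 :=
    primrec_termVal.comp (Primrec.pair (Primrec.snd.comp Primrec.fst) hb₂)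
  have hk : Primrec fun p : (ℕ × List A × List A) × List Bool =>
      (shortWords L u (lengthBound C K p.1.1 p.1.2.1 p.1.2.2)).length :=
    Primrec.list_length.comp ((primrec_shortWords hL u).comp
      ((primrec_lengthBound C K).comp Primrec.fst))
  have hget : ∀ i, Primrec fun p : (ℕ × List A × List A) × List Bool => p.2.getD i false :=
    fun i => (Primrec.list_getD false).comp hist (Primrec.const i)
  have hdrop : PrimrecPred fun p : (ℕ × List A × List A) × List Bool =>
      true ∈ p.2.drop (shortWords L u (lengthBound C K p.1.1 p.1.2.1 p.1.2.2)).length :=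
    primrecRel_mem.comp (Primrec.const true) (Primrec.list_drop.comp hk hist)
  have hcount : Primrec fun p : (ℕ × List A × List A) × List Bool =>
      ((p.2.take (shortWords L u (lengthBound C K p.1.1 p.1.2.1 p.1.2.2)).length).filter
        (· = true)).length :=
    Primrec.list_length.comp ((Primrec.listFilter (p := fun b : Bool => b = true)
      (Primrec.eq.comp Primrec.id (Primrec.const true))).comp (Primrec.list_take.comp hk hist))
  refine PrimrecPred.and (Primrec.eq.comp ((primrec_freeVarsOfCode hL).comp hc)
    (Primrec.const none)).not ?_
  refine ((tag 0).and (Primrec.eq.comp hs ht)).or (((tag 1).and (primrecRel_sublist.comp hs ht)).or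
    (((tag 2).and (primrecRel_covers.comp hs ht)).or (((tag 3).and ?_).or
    (((tag 4).and (Primrec.eq.comp (hget 0) (Primrec.const false))).or
    (((tag 5).and ((Primrec.eq.comp (hget 0) (Primrec.const true)).and
      (Primrec.eq.comp (hget 1) (Primrec.const true)))).or
    (((tag 6).and (primrecRel_mem.comp (Primrec.const true) hist)).or
    (((tag 7).and (hdrop.or (Primrec.nat_le.comp hb₁ hcount))).or
    ((tag 8).and (hdrop.not.and (Primrec.eq.comp (Primrec.nat_mod.comp hcount hb₁)
      (h₁.comp hb₂)))))))))))
  exact (primrecRel_accepts.comp (Primrec.option_getD.comp (Primrec.decode.comp hb₁)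
    (Primrec.const ([], [], []))) ht).and (hL.comp ht)

theorem fst_lt_of_mem_subInputs {A : Type*} {L : Language A} {u : List A} {C K : ℕ}
    {b b' : ℕ × List A × List A} (hb : b' ∈ subInputs L u C K b) : b'.1 < b.1 := by
  apply lt_of_mem_subCodes
  unfold subInputs at hb
  split_ifs at hb with h₁ h₂
  · obtain ⟨c, hc, rfl⟩ := mem_map.1 hb
    exact hc
  · obtain ⟨w, -, rfl⟩ := mem_map.1 hb
    unfold subCodes
    rw [if_neg (by omega), if_neg (by omega), if_pos (by omega)]
    exact mem_singleton_self _
  · simp at hb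

theorem primrecPred_satCode {A : Type*} [Finite A] [Primcodable A] {L : Language A}
    (hL : PrimrecPred fun w => w ∈ L) {K : ℕ} (hK : Recog K fun _ y => y ∈ L) :
    PrimrecPred (SatCode L) := by
  classical
  obtain ⟨u, hu, hu'⟩ : ∃ u : List A, (∀ a, a ∈ u) ∧ u.Nodup := by
    have := Fintype.ofFinite A
    exact ⟨Finset.univ.toList, fun a => Finset.mem_toList.2 (Finset.mem_univ a),
      Finset.nodup_toList _⟩
  have hstep : Primrec₂ fun b hist => some (decide (EvalStep L u (3 * Nat.card A + 9) K b hist)) :=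
    Primrec.option_some.comp (primrecRel_evalStep hL u _ K).decide
  refine Primrec.primrecPred (Primrec.nat_omega_rec' (fun b => decide (SatCode L b))
    (m := fun b => b.1) Primrec.fst (primrec_subInputs hL u (3 * Nat.card A + 9) K) hstep
    (fun b b' hb => fst_lt_of_mem_subInputs hb) fun b => congrArg some ?_)
  rw [decide_eq_decide]
  exact evalStep_iff hu hu' hK b

/-- For a sentence, one assignment decides whether it holds; the empty words are used even if they
are not in `L`. -/
theorem exists_mem_theory_iff {A : Type*} [Encodable A] {L : Language A} {n : ℕ} :
    (∃ φ ∈ theory L, φ.code = n) ↔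
      freeVarsOfCode L n = some (false, false) ∧ SatCode L (n, [], []) := by
  rw [freeVarsOfCode_eq_some_iff]
  have hbits : ∀ s : Finset (Fin 2), varBits s = (false, false) ↔ s = ∅ := by decide
  constructor
  · rintro ⟨φ, ⟨h, hs⟩, rfl⟩
    exact ⟨⟨φ, rfl, (hbits _).2 h⟩, φ, rfl, hs _⟩
  · rintro ⟨⟨φ, rfl, h⟩, hs⟩
    rw [satCode_iff] at hs
    have h' : φ.freeVars = ∅ := (hbits _).1 h
    refine ⟨φ, ⟨h', fun v => ?_⟩, rfl⟩
    refine (φ.sat_congr _ _ fun x hx => ?_).1 hs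
    rw [h'] at hx
    simp at hx

end CMod

theorem corollary4p10 {A : Type*} [Finite A] [Primcodable A] (L : Language A)
    (hL : L.IsRegular) : CMod.IsDecidable (CMod.theory L) := by
  obtain ⟨K, hK⟩ := CMod.exists_recog_of_isRegular hL
  obtain ⟨M, rfl⟩ := (CMod.isRegular_iff_exists_automaton L).1 hL
  have hM := CMod.primrecPred_mem_language M
  have h₁ : PrimrecPred fun n : ℕ => CMod.freeVarsOfCode M.language n = some (false, false) :=
    Primrec.eq.comp (CMod.primrec_freeVarsOfCode hM) (Primrec.const _)
  have h₂ : PrimrecPred fun n : ℕ => CMod.SatCode M.language (n, [], []) :=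
    (CMod.primrecPred_satCode hM hK).comp (Primrec.pair Primrec.id (Primrec.const _))
  exact ((h₁.and h₂).of_eq fun n => CMod.exists_mem_theory_iff.symm).computablePred
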